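/- Let $\mathcal C$ be a combinatorial model category, and let $\Sigma$ be the category obtained from $\Delta\times\Delta$ by adding a new terminal object $[-1]$. Write $(k,\ell)$ for $([k],[\ell])$. A preaugmented bisimplicial object in $\mathcal C$ is a functor $Y\colon\Sigma^{\mathrm{op}}\to\mathcal C$, with values $Y_{k,\ell}$ and $Y_{-1}$. It is injectively fibrant if $Y\to *$ has the right lifting property against all levelwise acyclic cofibrations in $\mathcal C^{\Sigma^{\mathrm{op}}}$. Let $s^h,t^h\colon(k,0)\to(k,\ell)$ be the identity in the first component and $0\mapsto 0$, respectively $0\mapsto\ell$, in the second; let $s^v,t^v\colon(0,\ell)\to(k,\ell)$ be $0\mapsto0$, respectively $0\mapsto k$, in the first component and the identity in the second. The induced maps of $Y$ are denoted by the same symbols, and $\times^h$ denotes homotopy pullbacks. The object $Y$ is an augmented stable double Segal object if the following hold. 1. (Double Segal) For all $q,r\ge1$ the maps induced by the inclusions of the spines, $$Y_{q,r}\to \underbrace{Y_{q,1}\times^h_{Y_{q,0}}\cdots\times^h_{Y_{q,0}}Y_{q,1}}_{r},\qquad Y_{q,r}\to \underbrace{Y_{1,r}\times^h_{Y_{0,r}}\cdots\times^h_{Y_{0,r}}Y_{1,r}}_{q},$$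 are weak equivalences. 2. (Stable) The maps $Y_{0,1}\times^h_{Y_{0,0}}Y_{1,0}\leftarrow Y_{1,1}\to Y_{1,0}\times^h_{Y_{0,0}}Y_{0,1}$, the first induced by the sources $s^v,s^h$ and the second by the targets $t^h,t^v$, are weak equivalences. 3. (Augmented) The composites $$Y_{1,0}\;{}^{t^v}\!\!\times^h_{Y_{0,0}}Y_{-1}\xrightarrow{\mathrm{pr}_1}Y_{1,0}\xrightarrow{s^v}Y_{0,0},\qquad Y_{0,1}\;{}^{s^h}\!\!\times^h_{Y_{0,0}}Y_{-1}\xrightarrow{\mathrm{pr}_1}Y_{0,1}\xrightarrow{t^h}Y_{0,0}$$ are weak equivalences. The initial path construction of $Y$ is the preaugmented bisimplicial object $P^{\triangleleft}Y$ whose underlying bisimplicial object is the composite of that of $Y$ with $([0]\star-)\times\mathrm{id}$, so that $(P^{\triangleleft}Y)_{q,r}=Y_{1+q,r}$; whose value at $[-1]$ is the (strict) pullback $(P^{\triangleleft}Y)_{-1}=Y_{1,0}\times_{Y_{0,0}}Y_{-1}$ along $t^v\colon Y_{1,0}\to Y_{0,0}$; and whose map $(P^{\triangleleft}Y)_{-1}\to(P^{\triangleleft}Y)_{0,0}=Y_{1,0}$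 is the first projection. If $Y$ is an injectively fibrant augmented stable double Segal object in $\mathcal C$, then $P^{\triangleleft}Y$ is an augmented stable double Segal object in $\mathcal C$. -/

import Mathlib

open CategoryTheory Limits HomotopicalAlgebra Opposite

universe w v u v₁ u₁

namespace DoubleSegal

noncomputable section

/-! ### Combinatorial model categories, injective fibrancy, homotopy limits -/

/-- A model category is combinatorial (with respect to the universe `w` of small sets) if its
underlying category is locally presentable and it is cofibrantly generated: there are small sets
`I` of generating cofibrations and `J` of generating trivial cofibrations. (In a locally
presentable category every small set of morphisms permits the small object argument.) -/
class IsCombinatorial (C : Type u) [Category.{v} C] [ModelCategory C] : Prop where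
  locallyPresentable : IsLocallyPresentable.{w} C
  exists_generating_cofibrations :
    ∃ I : MorphismProperty C, MorphismProperty.IsSmall.{w} I ∧ trivialFibrations C = I.rlp
  exists_generating_trivialCofibrations :
    ∃ J : MorphismProperty C, MorphismProperty.IsSmall.{w} J ∧ fibrations C = J.rlp

/-- A diagram `F : J ⥤ C` is injectively fibrant if the map from `F` to the terminal diagram has
the right lifting property against all levelwise trivial cofibrations, i.e. if `F` is a fibrant
object of the injective model structure on `J ⥤ C`. -/
def IsInjectivelyFibrant {C : Type u} [Category.{v} C] [ModelCategory C]
    {J : Type u₁} [Category.{v₁} J] (F : J ⥤ C) : Prop :=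
  ((trivialCofibrations C).functorCategory J).rlp (terminal.from F)

/-- An injectively fibrant replacement of a diagram: a levelwise weak equivalence to an
injectively fibrant diagram. -/
structure FibrantReplacement {C : Type u} [Category.{v} C] [ModelCategory C]
    {J : Type u₁} [Category.{v₁} J] (F : J ⥤ C) where
  /-- the replacing diagram -/
  diagram : J ⥤ C
  /-- the levelwise weak equivalence -/
  ι : F ⟶ diagram
  weakEquivalence (j : J) : WeakEquivalence (ι.app j)
  fibrant : IsInjectivelyFibrant diagram

/-- The cone `c` over `F` is a homotopy limit cone, i.e. the canonical map from its apex to the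
homotopy limit of `F` is a weak equivalence. The homotopy limit of `F` is the limit of an
injectively fibrant replacement of `F`. -/
def IsHomotopyLimit {C : Type u} [Category.{v} C] [ModelCategory C]
    {J : Type u₁} [Category.{v₁} J] {F : J ⥤ C} (c : Cone F) : Prop :=
  ∃ (R : FibrantReplacement F) (l : Cone R.diagram) (hl : IsLimit l),
    WeakEquivalence (hl.lift ((Cone.postcompose R.ι).obj c))

/-! ### Segal objects -/

/-- The shape `e₀ → v₁ ← e₁ → v₂ ← ⋯ → vₘ ← eₘ` of an `(m + 1)`-fold fibre product. -/
abbrev spineShape (m : ℕ) : MulticospanShape where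
  L := Fin (m + 1)
  R := Fin m
  fst := Fin.castSucc
  snd := Fin.succ

/-- The diagram `X₁ → X₀ ← X₁ → ⋯ ← X₁` with `m + 1` copies of `X₁` whose limit is the iterated
fibre product `X₁ ×_{X₀} ⋯ ×_{X₀} X₁`: the target of each edge is matched with the source of the
next one. -/
abbrev spineIndex {C : Type u} [Category.{v} C] (X : SimplicialObject C) (m : ℕ) :
    MulticospanIndex (spineShape m) C where
  left _ := X.obj (op (SimplexCategory.mk 1))
  right _ := X.obj (op (SimplexCategory.mk 0))
  fst _ := X.map (SimplexCategory.δ (n := 0) 0).op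
  snd _ := X.map (SimplexCategory.δ (n := 0) 1).op

/-- The cone `X_{m+1} → X₁ ×_{X₀} ⋯ ×_{X₀} X₁` induced by the inclusion of the spine into the
standard `(m + 1)`-simplex. -/
def spineCone {C : Type u} [Category.{v} C] (X : SimplicialObject C) (m : ℕ) :
    Multifork (spineIndex X m) :=
  Multifork.ofι (spineIndex X m) (X.obj (op (SimplexCategory.mk (m + 1))))
    (fun i => X.map (SimplexCategory.mkOfSucc (n := m + 1) i).op)
    (fun b => by
      change X.map (SimplexCategory.mkOfSucc (n := m + 1) b.castSucc).op ≫
          X.map (SimplexCategory.δ (n := 0) 0).op =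
        X.map (SimplexCategory.mkOfSucc (n := m + 1) b.succ).op ≫
          X.map (SimplexCategory.δ (n := 0) 1).op
      rw [← X.map_comp, ← X.map_comp, ← op_comp, ← op_comp, SimplexCategory.δ_zero_mkOfSucc,
        SimplexCategory.δ_one_mkOfSucc, Fin.succ_castSucc])

/-- The `n`-th Segal map `Xₙ → X₁ ×ʰ_{X₀} ⋯ ×ʰ_{X₀} X₁`, for `n = m + 1`, is a weak equivalence. -/
def SegalMapIsWeakEquivalence {C : Type u} [Category.{v} C] [ModelCategory C]
    (X : SimplicialObject C) (m : ℕ) : Prop :=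
  IsHomotopyLimit (spineCone X m)

/-! ### Bisimplicial objects -/

/-- The object `([k], [l])` of `Δ × Δ`. -/
abbrev bi (k l : ℕ) : SimplexCategory × SimplexCategory :=
  (SimplexCategory.mk k, SimplexCategory.mk l)

/-- `sʰ : (k, 0) ⟶ (k, l)`, given by `0 ↦ 0` in the second component. -/
abbrev sh (k l : ℕ) : bi k 0 ⟶ bi k l :=
  Prod.mkHom (𝟙 (SimplexCategory.mk k))
    (SimplexCategory.const (SimplexCategory.mk 0) (SimplexCategory.mk l) 0)

/-- `tʰ : (k, 0) ⟶ (k, l)`, given by `0 ↦ l` in the second component. -/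
abbrev th (k l : ℕ) : bi k 0 ⟶ bi k l :=
  Prod.mkHom (𝟙 (SimplexCategory.mk k))
    (SimplexCategory.const (SimplexCategory.mk 0) (SimplexCategory.mk l) (Fin.last l))

/-- `sᵛ : (0, l) ⟶ (k, l)`, given by `0 ↦ 0` in the first component. -/
abbrev sv (k l : ℕ) : bi 0 l ⟶ bi k l :=
  Prod.mkHom (SimplexCategory.const (SimplexCategory.mk 0) (SimplexCategory.mk k) 0)
    (𝟙 (SimplexCategory.mk l))

/-- `tᵛ : (0, l) ⟶ (k, l)`, given by `0 ↦ k` in the first component. -/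
abbrev tv (k l : ℕ) : bi 0 l ⟶ bi k l :=
  Prod.mkHom (SimplexCategory.const (SimplexCategory.mk 0) (SimplexCategory.mk k) (Fin.last k))
    (𝟙 (SimplexCategory.mk l))

/-- A bisimplicial object of `C`. -/
abbrev BisimplicialObject (C : Type u) [Category.{v} C] : Type (max v u) :=
  (SimplexCategory × SimplexCategory)ᵒᵖ ⥤ C

/-- The simplicial object `Z_{•,r}`. -/
abbrev fixSnd {C : Type u} [Category.{v} C] (Z : BisimplicialObject C) (r : ℕ) :
    SimplicialObject C :=
  (Prod.sectL SimplexCategory (SimplexCategory.mk r)).op ⋙ Z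

/-- The simplicial object `Z_{q,•}`. -/
abbrev fixFst {C : Type u} [Category.{v} C] (Z : BisimplicialObject C) (q : ℕ) :
    SimplicialObject C :=
  (Prod.sectR (SimplexCategory.mk q) SimplexCategory).op ⋙ Z

/-- A bisimplicial object `Z` is double Segal if for all `q, r ≥ 1` (here `q = a + 1` and
`r = b + 1`) the maps `Z_{q,r} → Z_{q,1} ×ʰ_{Z_{q,0}} ⋯ ×ʰ_{Z_{q,0}} Z_{q,1}` (`r` factors) and
`Z_{q,r} → Z_{1,r} ×ʰ_{Z_{0,r}} ⋯ ×ʰ_{Z_{0,r}} Z_{1,r}` (`q` factors) are weak equivalences. -/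
def IsDoubleSegal {C : Type u} [Category.{v} C] [ModelCategory C]
    (Z : BisimplicialObject C) : Prop :=
  ∀ a b : ℕ, SegalMapIsWeakEquivalence (fixFst Z (a + 1)) b ∧
    SegalMapIsWeakEquivalence (fixSnd Z (b + 1)) a

/-- The cone `Z_{0,1} ← Z_{1,1} → Z_{1,0}` over `Z_{0,1} → Z_{0,0} ← Z_{1,0}` given by the
sources. -/
def spanCone {C : Type u} [Category.{v} C] (Z : BisimplicialObject C) :
    PullbackCone (Z.map (sh 0 1).op) (Z.map (sv 1 0).op) :=
  PullbackCone.mk (Z.map (sv 1 1).op) (Z.map (sh 1 1).op) (by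
    rw [← Z.map_comp, ← Z.map_comp, ← op_comp, ← op_comp]
    congr 2)

/-- The cone `Z_{1,0} ← Z_{1,1} → Z_{0,1}` over `Z_{1,0} → Z_{0,0} ← Z_{0,1}` given by the
targets. -/
def cospanCone {C : Type u} [Category.{v} C] (Z : BisimplicialObject C) :
    PullbackCone (Z.map (tv 1 0).op) (Z.map (th 0 1).op) :=
  PullbackCone.mk (Z.map (th 1 1).op) (Z.map (tv 1 1).op) (by
    rw [← Z.map_comp, ← Z.map_comp, ← op_comp, ← op_comp]
    congr 2)

/-- Stability: the maps `Z_{0,1} ×ʰ_{Z_{0,0}} Z_{1,0} ← Z_{1,1} → Z_{1,0} ×ʰ_{Z_{0,0}} Z_{0,1}`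
induced by sources and by targets are weak equivalences. -/
def IsStable {C : Type u} [Category.{v} C] [ModelCategory C]
    (Z : BisimplicialObject C) : Prop :=
  IsHomotopyLimit (spanCone Z) ∧ IsHomotopyLimit (cospanCone Z)

/-! ### Preaugmented bisimplicial objects -/

/-- The category `Σ`, obtained from `Δ × Δ` by adding a new terminal object `[-1]`. -/
abbrev SigmaCat : Type := WithTerminal (SimplexCategory × SimplexCategory)

/-- A preaugmented bisimplicial object of `C` is a functor `Σᵒᵖ ⥤ C`. -/
abbrev PreaugmentedBisimplicialObject (C : Type u) [Category.{v} C] : Type (max v u) :=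
  SigmaCatᵒᵖ ⥤ C

/-- The underlying bisimplicial object `i^* Y`. -/
abbrev underlying {C : Type u} [Category.{v} C] (Y : PreaugmentedBisimplicialObject C) :
    BisimplicialObject C :=
  (WithTerminal.incl (C := SimplexCategory × SimplexCategory)).op ⋙ Y

/-- The object `Y_{-1}`. -/
abbrev minusOne {C : Type u} [Category.{v} C] (Y : PreaugmentedBisimplicialObject C) : C :=
  Y.obj (op WithTerminal.star)

/-- The map `Y_{-1} ⟶ Y_{0,0}`. -/
abbrev augmentation {C : Type u} [Category.{v} C] (Y : PreaugmentedBisimplicialObject C) :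
    minusOne Y ⟶ (underlying Y).obj (op (bi 0 0)) :=
  Y.map (WithTerminal.homFrom (bi 0 0)).op

/-- For morphisms `f : A ⟶ B`, `g : D ⟶ B` and `h : A ⟶ E`, the composite
`A ×ʰ_B D → A → E` of the first projection and `h` is a weak equivalence.

Here `A ×ʰ_B D` is the limit of an injectively fibrant replacement `A' → B' ← D'` of the cospan
`A → B ← D`. Its first projection lands in `A'` rather than in `A`, so `h` is represented by a map
`h' : A' ⟶ E'` which is identified with `h` by the weak equivalences `A ⟶ A'` and
`σ : E ⟶ E'`. -/
def ProjectionThenIsWeakEquivalence {C : Type u} [Category.{v} C] [ModelCategory C]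
    {A B D E : C} (f : A ⟶ B) (g : D ⟶ B) (h : A ⟶ E) : Prop :=
  ∃ (R : FibrantReplacement (cospan f g)) (l : Cone R.diagram) (_ : IsLimit l)
    (E' : C) (σ : E ⟶ E') (h' : R.diagram.obj WalkingCospan.left ⟶ E'),
    WeakEquivalence σ ∧ R.ι.app WalkingCospan.left ≫ h' = h ≫ σ ∧
      WeakEquivalence (l.π.app WalkingCospan.left ≫ h')

/-- A preaugmented bisimplicial object `Y` satisfies the augmentation condition if the composites
`Y_{1,0} ×ʰ_{Y_{0,0}} Y_{-1} → Y_{1,0} → Y_{0,0}` (homotopy pullback along `tᵛ`, followed by `sᵛ`)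
and `Y_{0,1} ×ʰ_{Y_{0,0}} Y_{-1} → Y_{0,1} → Y_{0,0}` (homotopy pullback along `sʰ`, followed by
`tʰ`) are weak equivalences. -/
def IsAugmented {C : Type u} [Category.{v} C] [ModelCategory C]
    (Y : PreaugmentedBisimplicialObject C) : Prop :=
  ProjectionThenIsWeakEquivalence ((underlying Y).map (tv 1 0).op) (augmentation Y)
      ((underlying Y).map (sv 1 0).op) ∧
    ProjectionThenIsWeakEquivalence ((underlying Y).map (sh 0 1).op) (augmentation Y)
      ((underlying Y).map (th 0 1).op)

/-- Augmented stable double Segal objects. -/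
structure IsAugmentedStableDoubleSegal {C : Type u} [Category.{v} C] [ModelCategory C]
    (Y : PreaugmentedBisimplicialObject C) : Prop where
  doubleSegal : IsDoubleSegal (underlying Y)
  stable : IsStable (underlying Y)
  augmented : IsAugmented Y

/-! ### The initial path construction -/

/-- The map `[0] ⋆ f : [0] ⋆ [m] ⟶ [0] ⋆ [n]`: `0 ↦ 0` and `i + 1 ↦ f i + 1`. -/
def joinMap {x y : SimplexCategory} (f : x ⟶ y) :
    SimplexCategory.mk (x.len + 1) ⟶ SimplexCategory.mk (y.len + 1) :=
  SimplexCategory.mkHom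
    { toFun := Fin.cases 0 (fun i => (f.toOrderHom i).succ)
      monotone' := by
        intro a b hab
        induction a using Fin.cases with
        | zero => exact Fin.zero_le _
        | succ a =>
          induction b using Fin.cases with
          | zero => exact absurd hab (by simp)
          | succ b =>
            simpa using f.toOrderHom.monotone (Fin.succ_le_succ_iff.mp hab) }

/-- The functor `Δ ⥤ Δ`, `[n] ↦ [0] ⋆ [n] = [1 + n]`. -/
def join : SimplexCategory ⥤ SimplexCategory where
  obj x := SimplexCategory.mk (x.len + 1)
  map f := joinMap f
  map_id x := by
    ext i : 3
    induction i using Fin.cases <;> rfl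
  map_comp f g := by
    ext i : 3
    induction i using Fin.cases <;> rfl

/-- The unique morphism from an object of `Δ × Δ` to the terminal object `(0, 0)`. -/
abbrev toZero (x : SimplexCategory × SimplexCategory) : x ⟶ bi 0 0 :=
  Prod.mkHom (SimplexCategory.const x.1 (SimplexCategory.mk 0) 0)
    (SimplexCategory.const x.2 (SimplexCategory.mk 0) 0)

/-- The bisimplicial object `(q, r) ↦ Z_{1+q,r}`, the composite of `Z` with `j × id`. -/
abbrev pathBisimplicial {C : Type u} [Category.{v} C] (Z : BisimplicialObject C) :
    BisimplicialObject C :=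
  (join.prod (𝟭 SimplexCategory)).op ⋙ Z

/-- The object `Y_{1,0} ×_{Y_{0,0}} Y_{-1}`, a strict pullback, where `Y_{1,0} ⟶ Y_{0,0}` is the
vertical target `tᵛ`. -/
abbrev pathMinusOne {C : Type u} [Category.{v} C] [HasPullbacks C]
    (Y : PreaugmentedBisimplicialObject C) : C :=
  pullback ((underlying Y).map (tv 1 0).op) (augmentation Y)

/-- The first projection `Y_{1,0} ×_{Y_{0,0}} Y_{-1} ⟶ Y_{1,0} = (P^◁ Y)_{0,0}`. -/
def pathAugmentation {C : Type u} [Category.{v} C] [HasPullbacks C]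
    (Y : PreaugmentedBisimplicialObject C) :
    pathMinusOne Y ⟶ (pathBisimplicial (underlying Y)).obj (op (bi 0 0)) :=
  pullback.fst ((underlying Y).map (tv 1 0).op) (augmentation Y)

/-- The initial path construction `P^◁ Y`: its underlying bisimplicial object is
`(q, r) ↦ Y_{1+q,r}`, its value at `[-1]` is `Y_{1,0} ×_{Y_{0,0}} Y_{-1}`, and the map from the
latter to `(P^◁ Y)_{0,0} = Y_{1,0}` is the first projection. The maps to the other
`(P^◁ Y)_{q,r}` are then forced, since `(q, r) ⟶ [-1]` factors through `(0, 0)`. -/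
def initialPath {C : Type u} [Category.{v} C] [HasPullbacks C]
    (Y : PreaugmentedBisimplicialObject C) : PreaugmentedBisimplicialObject C :=
  (WithTerminal.lift (Z := op (pathMinusOne Y)) (pathBisimplicial (underlying Y)).rightOp
    (fun x => (pathAugmentation Y ≫ (pathBisimplicial (underlying Y)).map (toZero x).op).op)
    (fun x y f => by
      apply Quiver.Hom.unop_inj
      have h : (toZero y).op ≫ f.op = (toZero x).op := rfl
      change (pathAugmentation Y ≫ (pathBisimplicial (underlying Y)).map (toZero y).op) ≫
        (pathBisimplicial (underlying Y)).map f.op =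
          pathAugmentation Y ≫ (pathBisimplicial (underlying Y)).map (toZero x).op
      rw [Category.assoc, ← (pathBisimplicial (underlying Y)).map_comp, h])).leftOp

end

end DoubleSegal

/-!
In an injectively fibrant diagram all values are fibrant and epimorphisms of the indexing category
induce fibrations, so by the cogluing lemma every homotopy limit in the definition of an augmented
stable double Segal object is computed by the strict limit, and each condition says that certain
squares are homotopy pullbacks. For a simplicial object `X` the Segal condition becomes
`X_{m+2} ≃ X_{m+1} ×ʰ_{X_0} X_1` for all `m`.

The path construction shifts the first index, and its squares arise from those of `Y` by pasting: a
Segal square of `[0] ⋆ -` by cancelling the one for `[2] = [0] ⋆ [1]`, and the stability and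
augmentation squares by pasting with the Segal square of `Y_{2,r} ≃ Y_{1,r} ×ʰ_{Y_{0,r}} Y_{1,r}`.
For `r = 0`, where no Segal condition in the first direction is imposed, it holds because `Y_{•,0}`
is a retract of `Y_{•,1}`.
-/

namespace DoubleSegal

section KenBrown

lemma weakEquivalence_map_of_map_trivialFibration {D : Type u} [Category.{v} D] [ModelCategory D]
    {E : Type u₁} [Category.{v₁} E] [CategoryWithWeakEquivalences E]
    [(weakEquivalences E).HasTwoOutOfThreeProperty] [(weakEquivalences E).ContainsIdentities]
    (G : D ⥤ E)
    (hG : ∀ ⦃X Y : D⦄ [IsFibrant X] [IsFibrant Y] (p : X ⟶ Y) [Fibration p] [WeakEquivalence p],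
      WeakEquivalence (G.map p))
    {X Y : D} [IsFibrant X] [IsFibrant Y] (f : X ⟶ Y) [WeakEquivalence f] :
    WeakEquivalence (G.map f) := by
  obtain ⟨F⟩ : Nonempty (FibrantBrownFactorization f) := inferInstance
  have : Fibration F.p := by simpa only [fibration_iff] using F.hp
  have : IsFibrant F.Z := isFibrant_of_fibration F.p
  have := hG F.p
  have := hG F.r
  have hir : G.map F.i ≫ G.map F.r = 𝟙 (G.obj X) := by rw [← G.map_comp, F.i_r, G.map_id]
  have := weakEquivalence_of_postcomp_of_fac hir
  rw [← F.fac, G.map_comp]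
  infer_instance

end KenBrown

section BaseChange

variable {C : Type u} [Category.{v} C] [ModelCategory C]

lemma exists_isPullback {X Y Z : C} (f : X ⟶ Z) (g : Y ⟶ Z) :
    ∃ (P : C) (a : P ⟶ X) (b : P ⟶ Y), IsPullback a b f g :=
  ⟨_, _, _, IsPullback.of_hasPullback f g⟩

lemma fibration_fst_of_isPullback {P X Y Z : C} {a : P ⟶ X} {b : P ⟶ Y} {f : X ⟶ Z} {g : Y ⟶ Z}
    (h : IsPullback a b f g) [Fibration g] : Fibration a := by
  rw [fibration_iff]
  exact MorphismProperty.of_isPullback h.flip (mem_fibrations g)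

lemma weakEquivalence_fst_of_isPullback_trivialFibration {P X Y Z : C} {a : P ⟶ X} {b : P ⟶ Y}
    {f : X ⟶ Z} {g : Y ⟶ Z} (h : IsPullback a b f g) [Fibration g] [WeakEquivalence g] :
    WeakEquivalence a := by
  rw [weakEquivalence_iff]
  exact (MorphismProperty.of_isPullback h.flip (mem_trivialFibrations g)).2

lemma isFibrant_overMk {Y Z : C} (q : Y ⟶ Z) [Fibration q] : IsFibrant (Over.mk q) :=
  (isFibrant_iff_of_isTerminal (Over.homMk q : Over.mk q ⟶ Over.mk (𝟙 Z)) Over.mkIdTerminal).2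
    ((fibrations_over_iff _ _).2 ‹Fibration q›)

lemma weakEquivalence_overPullback_map_of_trivialFibration {X Z : C} (f : X ⟶ Z) {U V : Over Z}
    (p : U ⟶ V) [Fibration p] [WeakEquivalence p] : WeakEquivalence ((Over.pullback f).map p) := by
  let φ : pullback U.hom f ⟶ pullback V.hom f := ((Over.pullback f).map p).left
  have hφ_fst : φ ≫ pullback.fst V.hom f = pullback.fst U.hom f ≫ p.left := pullback.lift_fst _ _ _
  have hφ_snd : φ ≫ pullback.snd V.hom f = pullback.snd U.hom f := pullback.lift_snd _ _ _
  have sq : IsPullback (pullback.fst U.hom f) φ p.left (pullback.fst V.hom f) :=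
    .of_bot (by simpa [hφ_snd] using IsPullback.of_hasPullback U.hom f) hφ_fst.symm
      (.of_hasPullback _ _)
  exact (weakEquivalences_over_iff _ _).2
    (weakEquivalence_fst_of_isPullback_trivialFibration sq.flip)

/-- Ken Brown's lemma for the base change functor `Over Z ⥤ Over X`. -/
lemma weakEquivalence_of_isPullback_fibrations {P P' X Y Y' Z : C} {a : P ⟶ X} {b : P ⟶ Y}
    {a' : P' ⟶ X} {b' : P' ⟶ Y'} {f : X ⟶ Z} {q : Y ⟶ Z} {q' : Y' ⟶ Z} (h : IsPullback a b f q)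
    (h' : IsPullback a' b' f q') [Fibration q] [Fibration q'] (e : Y ⟶ Y') [WeakEquivalence e]
    (he : e ≫ q' = q) (φ : P ⟶ P') (ha : φ ≫ a' = a) (hb : φ ≫ b' = b ≫ e) :
    WeakEquivalence φ := by
  have := isFibrant_overMk q
  have := isFibrant_overMk q'
  have : WeakEquivalence (Over.homMk e he : Over.mk q ⟶ Over.mk q') :=
    (weakEquivalences_over_iff _ _).2 ‹WeakEquivalence e›
  let φ₀ : pullback q f ⟶ pullback q' f := ((Over.pullback f).map
      (Over.homMk e he : Over.mk q ⟶ Over.mk q')).left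
  have hφ₀_fst : φ₀ ≫ pullback.fst q' f = pullback.fst q f ≫ e := pullback.lift_fst _ _ _
  have hφ₀_snd : φ₀ ≫ pullback.snd q' f = pullback.snd q f := pullback.lift_snd _ _ _
  have : WeakEquivalence φ₀ := (weakEquivalences_over_iff _ _).1 <|
    weakEquivalence_map_of_map_trivialFibration _
      (fun _ _ _ _ p _ _ => weakEquivalence_overPullback_map_of_trivialFibration f p) _
  have hφ : φ = h.flip.isoPullback.hom ≫ φ₀ ≫ h'.flip.isoPullback.inv :=
    h'.hom_ext (by simp [ha, hφ₀_snd]) (by simp [hb, hφ₀_fst])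
  rw [hφ]
  infer_instance

/-- Brown's trick: both `(𝟙, g) : E ⟶ E ×_X Q` and `i` are sections of trivial fibrations, and
pulling back the former along the latter, over `Q`, gives `j`. -/
lemma weakEquivalence_snd_of_section {P X Q E : C} {a : P ⟶ X} {j : P ⟶ E}
    {i : X ⟶ Q} {g : E ⟶ Q} (h : IsPullback a j i g) [Fibration g] (t : Q ⟶ X) [Fibration t]
    [WeakEquivalence t] (hit : i ≫ t = 𝟙 X) : WeakEquivalence j := by
  obtain ⟨E₁, E₁E, E₁Q, hE₁⟩ := exists_isPullback (g ≫ t) t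
  have := fibration_fst_of_isPullback hE₁.flip
  have := weakEquivalence_fst_of_isPullback_trivialFibration hE₁
  let s : E ⟶ E₁ := hE₁.lift (𝟙 E) g (by simp)
  have : WeakEquivalence s := weakEquivalence_of_postcomp_of_fac (hE₁.lift_fst _ _ _)
  let k : E ⟶ E₁ := hE₁.lift (𝟙 E) (g ≫ t ≫ i) (by simp [hit])
  have hk : IsPullback (g ≫ t) k i E₁Q := by
    refine (IsPullback.of_right ?_ (by simp [k]) hE₁).flip
    simpa [k, hit] using IsPullback.id_horiz (g ≫ t)
  exact weakEquivalence_of_isPullback_fibrations h hk s (by simp [s]) j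
    (by simp [← reassoc_of% h.w, hit]) (hE₁.hom_ext (by simp [k, s]) (by
      simp [k, s, ← h.w, ← reassoc_of% h.w, reassoc_of% hit]))

lemma weakEquivalence_snd_of_isPullback {P X Y Z : C} {a : P ⟶ X} {b : P ⟶ Y} {f : X ⟶ Z}
    {g : Y ⟶ Z} (h : IsPullback a b f g) [IsFibrant X] [IsFibrant Z] [Fibration g]
    [WeakEquivalence f] : WeakEquivalence b := by
  obtain ⟨F⟩ : Nonempty (FibrantBrownFactorization f) := inferInstance
  have : Fibration F.p := by simpa only [fibration_iff] using F.hp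
  obtain ⟨R, RF, RY, hR⟩ := exists_isPullback F.p g
  have := fibration_fst_of_isPullback hR
  have := weakEquivalence_fst_of_isPullback_trivialFibration hR.flip
  let j : P ⟶ R := hR.lift (a ≫ F.i) b (by simp [h.w])
  have hj : IsPullback a j F.i RF :=
    (IsPullback.of_right (by simpa [j] using h.flip) (by simp [j]) hR.flip).flip
  have := weakEquivalence_snd_of_section hj F.r F.i_r
  rw [← hR.lift_snd (a ≫ F.i) b (by simp [h.w])]
  infer_instance

/-- The cogluing lemma: the comparison map factors through the base change of `P'` along `x`. -/
lemma weakEquivalence_of_isPullback_of_isPullback {P X Y Z P' X' Y' Z' : C}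
    {a : P ⟶ X} {b : P ⟶ Y} {f : X ⟶ Z} {g : Y ⟶ Z} (h : IsPullback a b f g)
    {a' : P' ⟶ X'} {b' : P' ⟶ Y'} {f' : X' ⟶ Z'} {g' : Y' ⟶ Z'} (h' : IsPullback a' b' f' g')
    [IsFibrant X] [IsFibrant Z] [IsFibrant X'] [IsFibrant Z'] [Fibration g] [Fibration g']
    (x : X ⟶ X') (y : Y ⟶ Y') (z : Z ⟶ Z') [WeakEquivalence x] [WeakEquivalence y]
    [WeakEquivalence z] (hf : x ≫ f' = f ≫ z) (hg : y ≫ g' = g ≫ z) (φ : P ⟶ P')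
    (ha : φ ≫ a' = a ≫ x) (hb : φ ≫ b' = b ≫ y) : WeakEquivalence φ := by
  obtain ⟨R, RZ, RY, hR⟩ := exists_isPullback z g'
  have := fibration_fst_of_isPullback hR
  have := weakEquivalence_snd_of_isPullback hR
  let e : Y ⟶ R := hR.lift g y hg.symm
  have : WeakEquivalence e := weakEquivalence_of_postcomp_of_fac (hR.lift_snd g y hg.symm)
  obtain ⟨S, SX, SP, hS⟩ := exists_isPullback x a'
  have := fibration_fst_of_isPullback h'
  have := weakEquivalence_snd_of_isPullback hS
  have hS' : IsPullback SX (SP ≫ b') (f ≫ z) g' := by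
    rw [← hf]
    exact (hS.flip.paste_horiz h'.flip).flip
  let m : S ⟶ R := hR.lift (SX ≫ f) (SP ≫ b') (by simpa using hS'.w)
  have hm : IsPullback SX m f RZ :=
    (IsPullback.of_right (by simpa [m] using hS'.flip) (by simp [m]) hR.flip).flip
  let ψ : P ⟶ S := hS.lift a φ ha.symm
  have : WeakEquivalence ψ := weakEquivalence_of_isPullback_fibrations h hm e (by simp [e]) ψ
    (by simp [ψ]) (hR.hom_ext (by simp [ψ, m, e, h.w]) (by simp [ψ, m, e, hb]))
  rw [← hS.lift_snd a φ ha.symm]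
  infer_instance

end BaseChange

section HoPullback

variable {C : Type u} [Category.{v} C] [ModelCategory C]

/-- A commutative square whose comparison map to the strict pullback of `f` and `g` is a weak
equivalence. This is the notion of homotopy pullback square when the objects `X`, `Y`, `Z` are
fibrant and `f` or `g` is a fibration, which is the only case in which it is used. -/
structure IsHoPullback {P X Y Z : C} (fst : P ⟶ X) (snd : P ⟶ Y) (f : X ⟶ Z) (g : Y ⟶ Z) : Prop
    extends CommSq fst snd f g where
  weakEquivalence_lift : WeakEquivalence (pullback.lift fst snd w)

namespace IsHoPullback

variable {P X Y Z : C} {fst : P ⟶ X} {snd : P ⟶ Y} {f : X ⟶ Z} {g : Y ⟶ Z}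

lemma iff_of_isPullback {R : C} {a : R ⟶ X} {b : R ⟶ Y} (hR : IsPullback a b f g) (φ : P ⟶ R)
    (ha : φ ≫ a = fst) (hb : φ ≫ b = snd) : IsHoPullback fst snd f g ↔ WeakEquivalence φ := by
  have w : fst ≫ f = snd ≫ g := by rw [← ha, ← hb, Category.assoc, Category.assoc, hR.w]
  have hφ : pullback.lift fst snd w = φ ≫ hR.isoPullback.hom := by
    ext <;> simp [ha, hb, pullback.lift_fst, pullback.lift_snd]
  refine ⟨fun ⟨_, h⟩ => ?_, fun _ => ⟨⟨w⟩, hφ ▸ inferInstance⟩⟩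
  rw [hφ] at h
  exact weakEquivalence_of_postcomp φ hR.isoPullback.hom

lemma of_isPullback (h : IsPullback fst snd f g) : IsHoPullback fst snd f g :=
  (iff_of_isPullback h (𝟙 P) (by simp) (by simp)).2 inferInstance

lemma flip (h : IsHoPullback fst snd f g) : IsHoPullback snd fst g f :=
  have := h.weakEquivalence_lift
  (iff_of_isPullback (.flip (.of_hasPullback f g)) (pullback.lift fst snd h.w)
    (pullback.lift_snd _ _ _) (pullback.lift_fst _ _ _)).2 inferInstance

lemma weakEquivalence_fst (h : IsHoPullback fst snd f g) [IsFibrant Y] [IsFibrant Z]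
    [Fibration f] [WeakEquivalence g] : WeakEquivalence fst := by
  have := h.weakEquivalence_lift
  have := weakEquivalence_snd_of_isPullback (IsPullback.of_hasPullback f g).flip
  rw [← pullback.lift_fst fst snd h.w]
  infer_instance

lemma paste_horiz_iff {X₁₁ X₁₂ X₁₃ X₂₁ X₂₂ X₂₃ : C} {h₁₁ : X₁₁ ⟶ X₁₂} {h₁₂ : X₁₂ ⟶ X₁₃}
    {h₂₁ : X₂₁ ⟶ X₂₂} {h₂₂ : X₂₂ ⟶ X₂₃} {v₁₁ : X₁₁ ⟶ X₂₁} {v₁₂ : X₁₂ ⟶ X₂₂} {v₁₃ : X₁₃ ⟶ X₂₃}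
    [Fibration v₁₂] [Fibration v₁₃] (h : IsHoPullback h₁₂ v₁₂ v₁₃ h₂₂)
    (hw : h₁₁ ≫ v₁₂ = v₁₁ ≫ h₂₁) :
    IsHoPullback (h₁₁ ≫ h₁₂) v₁₁ v₁₃ (h₂₁ ≫ h₂₂) ↔ IsHoPullback h₁₁ v₁₁ v₁₂ h₂₁ := by
  let φ := pullback.lift h₁₂ v₁₂ h.w
  have : WeakEquivalence φ := h.weakEquivalence_lift
  have hR := IsPullback.of_hasPullback v₁₃ h₂₂
  have := fibration_fst_of_isPullback hR.flip
  obtain ⟨S, SX₁₂, SX₂₁, hS⟩ := exists_isPullback v₁₂ h₂₁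
  obtain ⟨T, TR, TX₂₁, hT⟩ := exists_isPullback (pullback.snd v₁₃ h₂₂) h₂₁
  let ψ : S ⟶ T := hT.lift (SX₁₂ ≫ φ) SX₂₁ (by simp [φ, hS.w, pullback.lift_snd])
  have : WeakEquivalence ψ := weakEquivalence_of_isPullback_fibrations hS.flip hT.flip φ
    (pullback.lift_snd _ _ _) ψ (by simp [ψ]) (by simp [ψ])
  let α : X₁₁ ⟶ S := hS.lift h₁₁ v₁₁ hw
  rw [iff_of_isPullback (hT.paste_horiz hR) (α ≫ ψ) (by simp [α, ψ, φ, pullback.lift_fst])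
      (by simp [α, ψ]), iff_of_isPullback hS α (by simp [α]) (by simp [α])]
  exact weakEquivalence_postcomp_iff α ψ

lemma paste_vert_iff {X₁₁ X₁₂ X₂₁ X₂₂ X₃₁ X₃₂ : C} {h₁₁ : X₁₁ ⟶ X₁₂} {h₂₁ : X₂₁ ⟶ X₂₂}
    {h₃₁ : X₃₁ ⟶ X₃₂} {v₁₁ : X₁₁ ⟶ X₂₁} {v₁₂ : X₁₂ ⟶ X₂₂} {v₂₁ : X₂₁ ⟶ X₃₁} {v₂₂ : X₂₂ ⟶ X₃₂}
    [Fibration h₂₁] [Fibration h₃₁] (h : IsHoPullback h₂₁ v₂₁ v₂₂ h₃₁)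
    (hw : h₁₁ ≫ v₁₂ = v₁₁ ≫ h₂₁) :
    IsHoPullback h₁₁ (v₁₁ ≫ v₂₁) (v₁₂ ≫ v₂₂) h₃₁ ↔ IsHoPullback h₁₁ v₁₁ v₁₂ h₂₁ :=
  ⟨fun hP => ((paste_horiz_iff h.flip hw.symm).1 hP.flip).flip,
    fun hP => ((paste_horiz_iff h.flip hw.symm).2 hP.flip).flip⟩

lemma iff_of_weakEquivalence {X' : C} {f' : X' ⟶ Z} (hw : fst ≫ f = snd ≫ g) (e : X ⟶ X')
    [WeakEquivalence e] (he : e ≫ f' = f) [IsFibrant X] [IsFibrant X'] [IsFibrant Z]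
    [Fibration g] : IsHoPullback fst snd f g ↔ IsHoPullback (fst ≫ e) snd f' g := by
  have hf := IsPullback.of_hasPullback f g
  have hf' := IsPullback.of_hasPullback f' g
  let ψ : pullback f g ⟶ pullback f' g :=
    hf'.lift (pullback.fst f g ≫ e) (pullback.snd f g) (by simp [he, hf.w])
  have : WeakEquivalence ψ := weakEquivalence_of_isPullback_of_isPullback hf hf' e (𝟙 Y) (𝟙 Z)
    (by simp [he]) (by simp) ψ (by simp [ψ]) (by simp [ψ])
  let α : P ⟶ pullback f g := hf.lift fst snd hw
  rw [iff_of_isPullback hf α (by simp [α]) (by simp [α]),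
    iff_of_isPullback hf' (α ≫ ψ) (by simp [α, ψ]) (by simp [α, ψ])]
  exact (weakEquivalence_postcomp_iff α ψ).symm

lemma map_of_retract {D : Type u₁} [Category.{v₁} D] {F G : D ⥤ C} (ρ : Retract F G)
    {p x y z : D} {a : p ⟶ x} {b : p ⟶ y} {c : x ⟶ z} {d : y ⟶ z} (sq : CommSq a b c d)
    (h : IsHoPullback (G.map a) (G.map b) (G.map c) (G.map d)) :
    IsHoPullback (F.map a) (F.map b) (F.map c) (F.map d) := by
  obtain ⟨R, Rx, Ry, hF⟩ := exists_isPullback (F.map c) (F.map d)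
  obtain ⟨S, Sx, Sy, hG⟩ := exists_isPullback (G.map c) (G.map d)
  have hρ (j : D) : ρ.i.app j ≫ ρ.r.app j = 𝟙 (F.obj j) := by
    rw [← NatTrans.comp_app, ρ.retract, NatTrans.id_app]
  let φ := hF.lift (F.map a) (F.map b) (sq.map F).w
  let ψ := hG.lift (G.map a) (G.map b) (sq.map G).w
  let i : R ⟶ S := hG.lift (Rx ≫ ρ.i.app x) (Ry ≫ ρ.i.app y)
    (by simpa using hF.w =≫ ρ.i.app z)
  let r : S ⟶ R := hF.lift (Sx ≫ ρ.r.app x) (Sy ≫ ρ.r.app y)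
    (by simpa using hG.w =≫ ρ.r.app z)
  let retractArrow : RetractArrow φ ψ :=
    { i := Arrow.homMk (ρ.i.app p) i (hG.hom_ext (by simp [φ, ψ, i]) (by simp [φ, ψ, i]))
      r := Arrow.homMk (ρ.r.app p) r (hF.hom_ext (by simp [φ, ψ, r]) (by simp [φ, ψ, r]))
      retract := by
        ext
        · exact hρ p
        · exact hF.hom_ext (by simp [i, r, hρ]) (by simp [i, r, hρ]) }
  rw [iff_of_isPullback hG ψ (by simp [ψ]) (by simp [ψ]), weakEquivalence_iff] at h
  rw [iff_of_isPullback hF φ (by simp [φ]) (by simp [φ]), weakEquivalence_iff]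
  exact MorphismProperty.of_retract retractArrow h

end IsHoPullback

lemma weakEquivalence_fst_comp_of_isHoPullback {U A A' B D E E' K : C} {u₁ u₃ : U ⟶ A}
    {u₂ : U ⟶ A'} {t : A ⟶ B} {m n : A' ⟶ B} {g : D ⟶ B} {p : E ⟶ A} {q : E ⟶ D} {p' : E' ⟶ A'}
    {q' : E' ⟶ D} {k : K ⟶ U} {l : K ⟶ E} [Fibration u₂] [Fibration t] [IsFibrant E']
    [IsFibrant B] (hU : IsHoPullback u₃ u₂ t n) (hw : u₁ ≫ t = u₂ ≫ m) (hE : IsPullback p q t g)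
    (hE' : IsPullback p' q' m g) [WeakEquivalence (p' ≫ n)] (hK : IsPullback k l u₁ p) :
    WeakEquivalence (k ≫ u₃) := by
  have hK' : IsPullback (l ≫ q) k g (u₂ ≫ m) := by
    rw [← hw]
    exact hK.flip.paste_horiz hE.flip
  let s : K ⟶ E' := hE'.lift (k ≫ u₂) (l ≫ q) (by simpa using hK'.w.symm)
  have hs : IsPullback k s u₂ p' :=
    (IsPullback.of_right (h₁₂ := q') (by simpa [s] using hK') (by simp [s]) hE'.flip).flip
  exact ((IsHoPullback.paste_horiz_iff hU hs.w).2 (.of_isPullback hs)).weakEquivalence_fst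

end HoPullback

section Lifting

variable {C : Type u} [Category.{v} C] [ModelCategory C]

lemma exists_lift_of_trivialCofibrations {A B X Y : C} {i : A ⟶ B} (hi : trivialCofibrations C i)
    (p : X ⟶ Y) [Fibration p] {a : A ⟶ X} {b : B ⟶ Y} (w : a ≫ p = i ≫ b) :
    ∃ l : B ⟶ X, i ≫ l = a ∧ l ≫ p = b := by
  obtain ⟨_, _⟩ := (mem_trivialCofibrations_iff i).1 hi
  have sq : CommSq a i p b := ⟨w⟩
  exact ⟨sq.lift, sq.fac_left, sq.fac_right⟩

lemma exists_extension_of_trivialCofibrations {A B X : C} [IsFibrant X] {i : A ⟶ B}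
    (hi : trivialCofibrations C i) (a : A ⟶ X) : ∃ l : B ⟶ X, i ≫ l = a := by
  obtain ⟨l, hl, -⟩ := exists_lift_of_trivialCofibrations hi (terminal.from X) (a := a)
    (Subsingleton.elim (a ≫ terminal.from X) (i ≫ terminal.from B))
  exact ⟨l, hl⟩

lemma fibration_of_forall_exists_lift {X Y : C} (p : X ⟶ Y)
    (h : ∀ ⦃A B : C⦄ (i : A ⟶ B), trivialCofibrations C i → ∀ (a : A ⟶ X) (b : B ⟶ Y),
      a ≫ p = i ≫ b → ∃ l : B ⟶ X, i ≫ l = a ∧ l ≫ p = b) : Fibration p := by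
  rw [fibration_iff, ← trivialCofibrations_rlp]
  intro A B i hi
  refine ⟨fun {a b} sq => ?_⟩
  obtain ⟨l, hl, hl'⟩ := h i hi a b sq.w
  exact ⟨⟨{ l := l, fac_left := hl, fac_right := hl' }⟩⟩

/-- The corner map of the square `∐_ι A → ∐_κ A`, `∐_ι B → ∐_κ B` lifts against fibrations one
summand `B` at a time: the lift is prescribed on the summands indexed by the range of `s` and
extends along `i` on the others. -/
lemma trivialCofibrations_desc_of_isPushout_sigma {ι κ : Type*} [Finite ι] [Finite κ] {s : ι → κ}
    (hs : Function.Injective s) {A B P : C} {i : A ⟶ B} (hi : trivialCofibrations C i)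
    {σ : (∐ fun _ : ι => A) ⟶ ∐ fun _ : κ => A} {τ : (∐ fun _ : ι => A) ⟶ ∐ fun _ : ι => B}
    {α : (∐ fun _ : κ => A) ⟶ P} {β : (∐ fun _ : ι => B) ⟶ P} (hP : IsPushout σ τ α β)
    (hσ : ∀ t, Sigma.ι (fun _ : ι => A) t ≫ σ = Sigma.ι (fun _ : κ => A) (s t))
    (hτ : ∀ t, Sigma.ι (fun _ : ι => A) t ≫ τ = i ≫ Sigma.ι (fun _ : ι => B) t)
    {φ : P ⟶ ∐ fun _ : κ => B}
    (hα : ∀ k, Sigma.ι (fun _ : κ => A) k ≫ α ≫ φ = i ≫ Sigma.ι (fun _ : κ => B) k)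
    (hβ : ∀ t, Sigma.ι (fun _ : ι => B) t ≫ β ≫ φ = Sigma.ι (fun _ : κ => B) (s t)) :
    trivialCofibrations C φ := by
  rw [← fibrations_llp]
  intro X Y p hp
  have : Fibration p := (fibration_iff p).2 hp
  refine ⟨fun {u v} sq => ?_⟩
  have exists_lift_summand (k : κ) : ∃ l : B ⟶ X, i ≫ l = Sigma.ι (fun _ => A) k ≫ α ≫ u ∧
      l ≫ p = Sigma.ι (fun _ => B) k ≫ v ∧
      ∀ t, s t = k → Sigma.ι (fun _ => B) t ≫ β ≫ u = l := by
    by_cases hk : ∃ t, s t = k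
    · obtain ⟨t, rfl⟩ := hk
      refine ⟨Sigma.ι (fun _ => B) t ≫ β ≫ u, ?_, ?_, fun t' ht' => by rw [hs ht']⟩
      · rw [← reassoc_of% hτ, ← hP.w_assoc, reassoc_of% hσ]
      · rw [Category.assoc, Category.assoc, sq.w, reassoc_of% hβ]
    · obtain ⟨l, hl, hl'⟩ := exists_lift_of_trivialCofibrations hi p
        (a := Sigma.ι (fun _ => A) k ≫ α ≫ u) (b := Sigma.ι (fun _ => B) k ≫ v)
        (by rw [Category.assoc, Category.assoc, sq.w, reassoc_of% hα])
      exact ⟨l, hl, hl', fun t ht => (hk ⟨t, ht⟩).elim⟩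
  choose l hil hlp hl using exists_lift_summand
  refine ⟨⟨{ l := Sigma.desc l, fac_left := hP.hom_ext ?_ ?_, fac_right := ?_ }⟩⟩
  · refine Sigma.hom_ext _ _ fun k => ?_
    rw [reassoc_of% hα, Sigma.ι_desc, hil]
  · refine Sigma.hom_ext _ _ fun t => ?_
    rw [reassoc_of% hβ, Sigma.ι_desc, hl (s t) t rfl]
  · refine Sigma.hom_ext _ _ fun k => ?_
    rw [Sigma.ι_desc_assoc, hlp]

end Lifting

section InjectivelyFibrant

variable {C : Type u} [Category.{v} C] [ModelCategory C] {J : Type u₁} [Category.{v₁} J]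

lemma isInjectivelyFibrant_iff (F : J ⥤ C) :
    IsInjectivelyFibrant F ↔ ∀ ⦃G H : J ⥤ C⦄ (i : G ⟶ H)
      (_ : ∀ j, trivialCofibrations C (i.app j)) (a : G ⟶ F), ∃ l : H ⟶ F, i ≫ l = a := by
  constructor
  · intro hF G H i hi a
    have := hF i hi
    have sq : CommSq a i (terminal.from F) (terminal.from H) := ⟨Subsingleton.elim _ _⟩
    exact ⟨sq.lift, sq.fac_left⟩
  · intro hF G H i hi
    refine ⟨fun {a b} sq => ?_⟩
    obtain ⟨l, hl⟩ := hF i hi a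
    exact ⟨⟨{ l := l, fac_left := hl, fac_right := Subsingleton.elim _ _ }⟩⟩

variable [∀ x y : J, Finite (x ⟶ y)]

section Evaluation

variable (C) in
/-- The natural transformation `Hom(y, -) ⊗ A ⟶ Hom(x, -) ⊗ A` given by precomposition with `f`,
as the mate of `F.map f` under the adjunctions of the evaluation functors. -/
noncomputable def evaluationLeftAdjointMap {x y : J} (f : x ⟶ y) :
    evaluationLeftAdjoint C y ⟶ evaluationLeftAdjoint C x :=
  (conjugateEquiv (evaluationAdjunctionRight C x) (evaluationAdjunctionRight C y)).symm
    ((evaluation J C).map f)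

/-- The inclusion of the summand of `Hom(x, j) ⊗ A` indexed by `t`. -/
noncomputable def evaluationLeftAdjointι (A : C) {x j : J} (t : x ⟶ j) :
    A ⟶ ((evaluationLeftAdjoint C x).obj A).obj j :=
  Sigma.ι (fun _ : x ⟶ j => A) t

lemma evaluationLeftAdjointι_map (A : C) {x j k : J} (t : x ⟶ j) (u : j ⟶ k) :
    evaluationLeftAdjointι A t ≫ ((evaluationLeftAdjoint C x).obj A).map u =
      evaluationLeftAdjointι A (t ≫ u) :=
  Sigma.ι_desc _ _

lemma evaluationLeftAdjointι_map_app {A B : C} (i : A ⟶ B) {x j : J} (t : x ⟶ j) :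
    evaluationLeftAdjointι A t ≫ ((evaluationLeftAdjoint C x).map i).app j =
      i ≫ evaluationLeftAdjointι B t :=
  Sigma.ι_desc _ _

lemma evaluationAdjunctionRight_homEquiv_apply {x : J} {A : C} {F : J ⥤ C}
    (l : (evaluationLeftAdjoint C x).obj A ⟶ F) :
    (evaluationAdjunctionRight C x).homEquiv A F l = evaluationLeftAdjointι A (𝟙 x) ≫ l.app x := by
  rw [Adjunction.homEquiv_unit, evaluationAdjunctionRight_unit_app]
  rfl

lemma evaluationLeftAdjointι_id_comp_evaluationLeftAdjointMap (A : C) {x y : J} (f : x ⟶ y) :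
    evaluationLeftAdjointι A (𝟙 y) ≫ ((evaluationLeftAdjointMap C f).app A).app y =
      evaluationLeftAdjointι A f := by
  have h := unit_conjugateEquiv_symm (evaluationAdjunctionRight C x)
    (evaluationAdjunctionRight C y) ((evaluation J C).map f) A
  rw [evaluationAdjunctionRight_unit_app, evaluationAdjunctionRight_unit_app] at h
  refine h.symm.trans ((evaluationLeftAdjointι_map A (𝟙 x) f).trans ?_)
  rw [Category.id_comp]

lemma evaluationLeftAdjointι_comp_evaluationLeftAdjointMap (A : C) {x y j : J} (f : x ⟶ y)
    (t : y ⟶ j) :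
    evaluationLeftAdjointι A t ≫ ((evaluationLeftAdjointMap C f).app A).app j =
      evaluationLeftAdjointι A (f ≫ t) := by
  rw [← Category.id_comp t, ← evaluationLeftAdjointι_map, Category.assoc, NatTrans.naturality,
    ← Category.assoc, evaluationLeftAdjointι_id_comp_evaluationLeftAdjointMap,
    evaluationLeftAdjointι_map, Category.id_comp]

lemma homEquiv_evaluationLeftAdjointMap_comp {x y : J} (f : x ⟶ y) {A : C} {F : J ⥤ C}
    (l : (evaluationLeftAdjoint C x).obj A ⟶ F) :
    (evaluationAdjunctionRight C y).homEquiv A F ((evaluationLeftAdjointMap C f).app A ≫ l) =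
      (evaluationAdjunctionRight C x).homEquiv A F l ≫ F.map f := by
  rw [evaluationAdjunctionRight_homEquiv_apply, evaluationAdjunctionRight_homEquiv_apply,
    NatTrans.comp_app, Category.assoc, ← l.naturality, reassoc_of% evaluationLeftAdjointι_map,
    Category.id_comp, reassoc_of% evaluationLeftAdjointι_id_comp_evaluationLeftAdjointMap]

end Evaluation

lemma IsInjectivelyFibrant.isFibrant {F : J ⥤ C} (hF : IsInjectivelyFibrant F) (x : J) :
    IsFibrant (F.obj x) := by
  refine fibration_of_forall_exists_lift _ fun A B i hi a b _ => ?_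
  have hLi (j : J) : trivialCofibrations C (((evaluationLeftAdjoint C x).map i).app j) := by
    have h : ((evaluationLeftAdjoint C x).map i).app j = Limits.Sigma.map fun _ : x ⟶ j => i :=
      Sigma.hom_ext _ _ fun t =>
        (evaluationLeftAdjointι_map_app i t).trans (Sigma.ι_map (fun _ : x ⟶ j => i) t).symm
    rw [h]
    exact MorphismProperty.colimMap (W := trivialCofibrations C) _ fun _ => hi
  obtain ⟨l, hl⟩ := (isInjectivelyFibrant_iff F).1 hF _ hLi
    (((evaluationAdjunctionRight C x).homEquiv A F).symm a)
  refine ⟨(evaluationAdjunctionRight C x).homEquiv B F l, ?_, Subsingleton.elim _ _⟩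
  rw [← Adjunction.homEquiv_naturality_left, hl, Equiv.apply_symm_apply]

/-- By adjunction, a lifting problem of `i : A ⟶ B` against `F.map f` is an extension problem
along the corner map `Hom(x, -) ⊗ A ⊔ Hom(y, -) ⊗ B ⟶ Hom(x, -) ⊗ B`, which is a levelwise trivial
cofibration because `Hom(y, -) → Hom(x, -)` is injective. -/
lemma IsInjectivelyFibrant.fibration_map {F : J ⥤ C} (hF : IsInjectivelyFibrant F) {x y : J}
    (f : x ⟶ y) [Epi f] : Fibration (F.map f) := by
  refine fibration_of_forall_exists_lift _ fun A B i hi a b w => ?_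
  let adj (z : J) := evaluationAdjunctionRight C z
  let σ := evaluationLeftAdjointMap C f
  have hP := IsPushout.of_hasPushout (σ.app A) ((evaluationLeftAdjoint C y).map i)
  let φ := hP.desc ((evaluationLeftAdjoint C x).map i) (σ.app B) (σ.naturality i).symm
  have hφ (j : J) : trivialCofibrations C (φ.app j) := by
    refine trivialCofibrations_desc_of_isPushout_sigma (s := fun t : y ⟶ j => f ≫ t)
      (fun t t' h => (cancel_epi f).1 h) hi (hP.map ((evaluation J C).obj j))
      (evaluationLeftAdjointι_comp_evaluationLeftAdjointMap A f) (evaluationLeftAdjointι_map_app i)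
      (fun t => ?_) (fun t => ?_)
    · have h := NatTrans.congr_app (hP.inl_desc _ _ (σ.naturality i).symm) j
      exact (Sigma.ι (fun _ => A) t ≫= h).trans (evaluationLeftAdjointι_map_app i t)
    · have h := NatTrans.congr_app (hP.inr_desc _ _ (σ.naturality i).symm) j
      exact (Sigma.ι (fun _ => B) t ≫= h).trans
        (evaluationLeftAdjointι_comp_evaluationLeftAdjointMap B f t)
  have hab : σ.app A ≫ ((adj x).homEquiv A F).symm a =
      (evaluationLeftAdjoint C y).map i ≫ ((adj y).homEquiv B F).symm b := by
    apply ((adj y).homEquiv A F).injective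
    rw [homEquiv_evaluationLeftAdjointMap_comp, Adjunction.homEquiv_naturality_left,
      Equiv.apply_symm_apply, Equiv.apply_symm_apply, w]
  obtain ⟨l, hl⟩ := (isInjectivelyFibrant_iff F).1 hF φ hφ (hP.desc _ _ hab)
  have hil : (evaluationLeftAdjoint C x).map i ≫ l = ((adj x).homEquiv A F).symm a := by
    rw [← hP.inl_desc _ _ hab, ← hl, hP.inl_desc_assoc]
  have hσl : σ.app B ≫ l = ((adj y).homEquiv B F).symm b := by
    rw [← hP.inr_desc _ _ hab, ← hl, hP.inr_desc_assoc]
  refine ⟨(adj x).homEquiv B F l, ?_, ?_⟩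
  · rw [← Adjunction.homEquiv_naturality_left, hil, Equiv.apply_symm_apply]
  · rw [← homEquiv_evaluationLeftAdjointMap_comp, hσl, Equiv.apply_symm_apply]

end InjectivelyFibrant

section HomotopyLimit

variable {C : Type u} [Category.{v} C] [ModelCategory C]

lemma isHomotopyLimit_iff_weakEquivalence_lift {J : Type u₁} [Category.{v₁} J]
    [HasLimitsOfShape J C] {F : J ⥤ C} [Nonempty (FibrantReplacement F)] {s : Cone F}
    (hs : IsLimit s) (hR : ∀ (R : FibrantReplacement F) {l : Cone R.diagram} (hl : IsLimit l),
      WeakEquivalence (hl.map s R.ι)) (c : Cone F) :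
    IsHomotopyLimit c ↔ WeakEquivalence (hs.lift c) := by
  have key (R : FibrantReplacement F) {l : Cone R.diagram} (hl : IsLimit l) :
      WeakEquivalence (hl.lift ((Cone.postcompose R.ι).obj c)) ↔ WeakEquivalence (hs.lift c) := by
    have := hR R hl
    have h : hl.lift ((Cone.postcompose R.ι).obj c) = hs.lift c ≫ hl.map s R.ι :=
      hl.hom_ext fun j => by simp
    rw [h, weakEquivalence_postcomp_iff]
  refine ⟨fun ⟨R, l, hl, h⟩ => (key R hl).1 h, fun h => ?_⟩
  obtain ⟨R⟩ := ‹Nonempty (FibrantReplacement F)›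
  exact ⟨R, _, limit.isLimit _, (key R _).2 h⟩

lemma weakEquivalence_isLimitMap_cospan {F G : WalkingCospan ⥤ C} (hF : ∀ j, IsFibrant (F.obj j))
    (hG : ∀ j, IsFibrant (G.obj j)) [Fibration (F.map WalkingCospan.Hom.inl)]
    [Fibration (G.map WalkingCospan.Hom.inl)] (α : F ⟶ G) (hα : ∀ j, WeakEquivalence (α.app j))
    {s : Cone F} (hs : IsLimit s) {l : Cone G} (hl : IsLimit l) :
    WeakEquivalence (hl.map s α) :=
  have := hF .right
  have := hF .one
  have := hG .right
  have := hG .one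
  have := hα .left
  have := hα .right
  have := hα .one
  weakEquivalence_of_isPullback_of_isPullback (IsPullback.of_isLimit_cone hs).flip
    (IsPullback.of_isLimit_cone hl).flip (α.app .right) (α.app .left) (α.app .one)
    (α.naturality _).symm (α.naturality _).symm _ (hl.map_π _ _ _) (hl.map_π _ _ _)

lemma isInjectivelyFibrant_cospan {A B D : C} (f : A ⟶ B) (g : D ⟶ B) [Fibration f] [Fibration g]
    [IsFibrant B] : IsInjectivelyFibrant (cospan f g) := by
  rw [isInjectivelyFibrant_iff]
  intro G H i hi a
  let a_one : G.obj .one ⟶ B := a.app .one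
  obtain ⟨b, hb⟩ := exists_extension_of_trivialCofibrations (hi .one) a_one
  have exists_leg {j : WalkingCospan} (φ : j ⟶ .one) {E : C} (p : E ⟶ B) [Fibration p]
      (e : G.obj j ⟶ E) (he : e ≫ p = G.map φ ≫ a_one) :
      ∃ k, i.app j ≫ k = e ∧ k ≫ p = H.map φ ≫ b :=
    exists_lift_of_trivialCofibrations (hi j) p (by rw [← i.naturality_assoc, hb, he])
  obtain ⟨l, hl, hlf⟩ := exists_leg WalkingCospan.Hom.inl f (a.app .left)
    (a.naturality WalkingCospan.Hom.inl).symm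
  obtain ⟨r, hr, hrg⟩ := exists_leg WalkingCospan.Hom.inr g (a.app .right)
    (a.naturality WalkingCospan.Hom.inr).symm
  refine ⟨cospanHomMk b l r hlf.symm hrg.symm, ?_⟩
  ext (_ | _ | _)
  exacts [hb, hl, hr]

variable {A B D : C} {f : A ⟶ B} {g : D ⟶ B} [Fibration f]

lemma exists_fibrantReplacement_cospan [IsFibrant B] (g : D ⟶ B) :
    ∃ R : FibrantReplacement (cospan f g), IsIso (R.ι.app .left) := by
  let F := MorphismProperty.factorizationData (trivialCofibrations C) (fibrations C) g
  refine ⟨{ diagram := cospan f F.p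
            ι := cospanHomMk (𝟙 B) (𝟙 A) F.i (by simp) (by simp)
            weakEquivalence := ?_
            fibrant := isInjectivelyFibrant_cospan f F.p },
    (inferInstance : IsIso (𝟙 A))⟩
  rintro (_ | _ | _)
  exacts [(inferInstance : WeakEquivalence (𝟙 B)), (inferInstance : WeakEquivalence (𝟙 A)),
    (inferInstance : WeakEquivalence F.i)]

variable [IsFibrant A] [IsFibrant B] [IsFibrant D]

lemma FibrantReplacement.weakEquivalence_isLimitMap_cospan (R : FibrantReplacement (cospan f g))
    {s : Cone (cospan f g)} (hs : IsLimit s) {l : Cone R.diagram} (hl : IsLimit l) :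
    WeakEquivalence (hl.map s R.ι) := by
  have : Epi WalkingCospan.Hom.inl := ⟨fun _ _ _ => Subsingleton.elim _ _⟩
  have := R.fibrant.fibration_map WalkingCospan.Hom.inl
  have : Fibration ((cospan f g).map WalkingCospan.Hom.inl) := ‹Fibration f›
  refine DoubleSegal.weakEquivalence_isLimitMap_cospan ?_ R.fibrant.isFibrant R.ι
    R.weakEquivalence hs hl
  rintro (_ | _ | _)
  exacts [‹IsFibrant B›, ‹IsFibrant A›, ‹IsFibrant D›]

lemma isHomotopyLimit_iff_isHoPullback (c : PullbackCone f g) :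
    IsHomotopyLimit c ↔ IsHoPullback c.fst c.snd f g := by
  have : Nonempty (FibrantReplacement (cospan f g)) := (exists_fibrantReplacement_cospan g).nonempty
  have hs := pullbackIsPullback f g
  exact (isHomotopyLimit_iff_weakEquivalence_lift hs
    (fun R _ hl => R.weakEquivalence_isLimitMap_cospan hs hl) c).trans
    (IsHoPullback.iff_of_isPullback (.of_hasPullback f g) (hs.lift c) (hs.fac c .left)
      (hs.fac c .right)).symm

lemma projectionThenIsWeakEquivalence_iff {P E : C} {h : A ⟶ E} {a : P ⟶ A} {b : P ⟶ D}
    (hP : IsPullback a b f g) :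
    ProjectionThenIsWeakEquivalence f g h ↔ WeakEquivalence (a ≫ h) := by
  have key (R : FibrantReplacement (cospan f g)) {l : Cone R.diagram} (hl : IsLimit l) {E' : C}
      (σ : E ⟶ E') [WeakEquivalence σ] {h' : R.diagram.obj .left ⟶ E'}
      (hh' : R.ι.app .left ≫ h' = h ≫ σ) :
      WeakEquivalence (l.π.app .left ≫ h') ↔ WeakEquivalence (a ≫ h) := by
    let φ : P ⟶ l.pt := hl.map hP.cone R.ι
    have : WeakEquivalence φ := R.weakEquivalence_isLimitMap_cospan hP.isLimit hl
    let x : A ⟶ R.diagram.obj .left := R.ι.app .left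
    have hx : x ≫ h' = h ≫ σ := hh'
    have hφ : φ ≫ l.π.app .left = a ≫ x := hl.map_π _ _ _
    rw [← weakEquivalence_precomp_iff φ, reassoc_of% hφ, hx, ← Category.assoc,
      weakEquivalence_postcomp_iff]
  refine ⟨fun ⟨R, l, hl, E', σ, h', _, hh', H⟩ => (key R hl σ hh').1 H, fun H => ?_⟩
  obtain ⟨R, _⟩ := exists_fibrantReplacement_cospan (f := f) g
  have hh' : R.ι.app .left ≫ inv (R.ι.app .left) ≫ h = h ≫ 𝟙 E := by
    rw [Category.comp_id]
    exact IsIso.hom_inv_id_assoc _ _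
  exact ⟨R, _, limit.isLimit _, E, 𝟙 E, _, inferInstance, hh',
    (key R (limit.isLimit _) (𝟙 E) hh').2 H⟩

end HomotopyLimit

section Spine

variable {C : Type u} [Category.{v} C]

/-- A natural transformation between diagrams of multicospan shape. -/
def multicospanHomMk {J : MulticospanShape.{w, v₁}} {F G : WalkingMulticospan J ⥤ C}
    (l : ∀ a, F.obj (.left a) ⟶ G.obj (.left a)) (r : ∀ b, F.obj (.right b) ⟶ G.obj (.right b))
    (hfst : ∀ b, F.map (WalkingMulticospan.Hom.fst b) ≫ r b =
      l _ ≫ G.map (WalkingMulticospan.Hom.fst b))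
    (hsnd : ∀ b, F.map (WalkingMulticospan.Hom.snd b) ≫ r b =
      l _ ≫ G.map (WalkingMulticospan.Hom.snd b)) : F ⟶ G where
  app := fun
    | .left a => l a
    | .right b => r b
  naturality := by
    rintro _ _ (_ | b | b)
    · simp
    · exact hfst b
    · exact hsnd b

/-- The category `e₀ → v₀ ← e₁ → v₁ ← ⋯ → vₘ₋₁ ← eₘ` of edges and inner vertices of the spine of
the standard `(m + 1)`-simplex. -/
abbrev Spine (m : ℕ) : Type :=
  WalkingMulticospan (spineShape m)

namespace Spine

/-- The edge `eₐ` of the spine. -/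
abbrev edge {m : ℕ} (a : Fin (m + 1)) : Spine m :=
  .left a

/-- The inner vertex of the spine between the edges `e_b` and `e_{b + 1}`. -/
abbrev vertex {m : ℕ} (b : Fin m) : Spine m :=
  .right b

/-- The inclusion of an inner vertex of the spine as the target of the edge before it. -/
abbrev target {m : ℕ} (b : Fin m) : edge b.castSucc ⟶ vertex b :=
  WalkingMulticospan.Hom.fst (J := spineShape m) b

/-- The inclusion of an inner vertex of the spine as the source of the edge after it. -/
abbrev source {m : ℕ} (b : Fin m) : edge b.succ ⟶ vertex b :=
  WalkingMulticospan.Hom.snd (J := spineShape m) b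

/-- The inclusion of the first `m + 1` edges into the spine with `m + 2` edges. -/
def init (m : ℕ) : Spine m ⥤ Spine (m + 1) where
  obj := fun
    | .left a => edge a.castSucc
    | .right b => vertex b.castSucc
  map := fun
    | .id _ => 𝟙 _
    | .fst b => target b.castSucc
    | .snd b => source b.castSucc
  map_comp := by
    rintro (_ | _) _ _ (_ | _ | _) (_ | _ | _)
    all_goals exact (Category.id_comp _).symm

variable {m : ℕ} {T : C}

lemma hom_ext_of_isLimit {F : Spine m ⥤ C} {l : Cone F} (hl : IsLimit l) {r r' : T ⟶ l.pt}
    (h : ∀ a, r ≫ l.π.app (edge a) = r' ≫ l.π.app (edge a)) : r = r' := by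
  refine hl.hom_ext ?_
  rintro (a | b)
  · exact h a
  · rw [← l.w (target b), reassoc_of% h b.castSucc]

lemma exists_lift_of_isLimit {F : Spine m ⥤ C} {l : Cone F} (hl : IsLimit l)
    (q : ∀ a, T ⟶ F.obj (edge a))
    (hq : ∀ b : Fin m, q b.castSucc ≫ F.map (target b) = q b.succ ≫ F.map (source b)) :
    ∃ r : T ⟶ l.pt, ∀ a, r ≫ l.π.app (edge a) = q a :=
  let c : Cone F :=
    { pt := T
      π := multicospanHomMk (F := (Functor.const _).obj T) q
        (fun b => q b.castSucc ≫ F.map (target b)) (fun _ => Category.id_comp _)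
        (fun b => (Category.id_comp _).trans (hq b)) }
  ⟨hl.lift c, fun a => hl.fac c (edge a)⟩

lemma isIso_π_zero {F : Spine 0 ⥤ C} {l : Cone F} (hl : IsLimit l) :
    IsIso (l.π.app (edge 0)) := by
  obtain ⟨r, hr⟩ := exists_lift_of_isLimit hl (T := F.obj (edge 0))
    (Fin.cases (𝟙 _) fun b => b.elim0) fun b => b.elim0
  have hr_zero : r ≫ l.π.app (edge 0) = 𝟙 (F.obj (edge 0)) := hr 0
  exact ⟨r, hom_ext_of_isLimit hl (Fin.cases (by simp [hr_zero]) fun b => b.elim0), hr_zero⟩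

lemma isPullback_init {F : Spine (m + 1) ⥤ C} {k : Cone (init m ⋙ F)} (hk : IsLimit k)
    {l : Cone F} (hl : IsLimit l) :
    IsPullback (hk.lift (l.whisker (init m))) (l.π.app (edge (Fin.last (m + 1))))
      (k.π.app (edge (Fin.last m)) ≫ F.map (target (Fin.last m)))
      (F.map (source (Fin.last m))) := by
  let p (a : Fin (m + 1)) : k.pt ⟶ F.obj (edge a.castSucc) := k.π.app (edge a)
  let φ : l.pt ⟶ k.pt := hk.lift (l.whisker (init m))
  have hφ (a : Fin (m + 1)) : φ ≫ p a = l.π.app (edge a.castSucc) := hk.fac _ _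
  have hp (b : Fin m) : p b.castSucc ≫ F.map (target b.castSucc) =
      p b.succ ≫ F.map (source b.castSucc) := (k.w (target b)).trans (k.w (source b)).symm
  have exists_lift (c : PullbackCone (p (Fin.last m) ≫ F.map (target (Fin.last m)))
      (F.map (source (Fin.last m)))) :
      ∃ r : c.pt ⟶ l.pt, r ≫ φ = c.fst ∧ r ≫ l.π.app (edge (Fin.last (m + 1))) = c.snd := by
    let q (a : Fin (m + 2)) : c.pt ⟶ F.obj (edge a) :=
      Fin.lastCases (motive := fun a => c.pt ⟶ F.obj (edge a)) c.snd (fun a => c.fst ≫ p a) a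
    have hq (a : Fin (m + 1)) : q a.castSucc = c.fst ≫ p a := Fin.lastCases_castSucc _
    have hq_last : q (Fin.last (m + 1)) = c.snd := Fin.lastCases_last
    obtain ⟨r, hr⟩ := exists_lift_of_isLimit hl q <| Fin.lastCases
      (by rw [hq, Category.assoc, c.condition, ← hq_last]; rfl)
      fun b => by rw [hq, Category.assoc, hp, ← Category.assoc, ← hq]; rfl
    have hr_init (a : Fin (m + 1)) : (r ≫ φ) ≫ p a = c.fst ≫ p a := by
      rw [Category.assoc, hφ, hr, hq]
    exact ⟨r, hom_ext_of_isLimit hk hr_init, (hr _).trans hq_last⟩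
  choose r hr_fst hr_snd using exists_lift
  refine ⟨⟨?_⟩, ⟨PullbackCone.IsLimit.mk _ r hr_fst hr_snd fun c r' h_fst h_snd => ?_⟩⟩
  · exact (Category.assoc _ _ _).symm.trans ((hφ (Fin.last m) =≫ _).trans
      ((l.w (target (Fin.last m))).trans (l.w (source (Fin.last m))).symm))
  · refine hom_ext_of_isLimit hl fun a => ?_
    induction a using Fin.lastCases with
    | last => exact h_snd.trans (hr_snd c).symm
    | cast a =>
      rw [← hφ, ← Category.assoc, ← Category.assoc]
      exact (h_fst.trans (hr_fst c).symm) =≫ p a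

variable [ModelCategory C]

lemma isFibrant_pt {F : Spine m ⥤ C} (hF : ∀ j, IsFibrant (F.obj j))
    (hs : ∀ b, Fibration (F.map (source b))) {l : Cone F} (hl : IsLimit l) : IsFibrant l.pt := by
  induction m with
  | zero =>
    have := isIso_π_zero hl
    have := hF (edge 0)
    exact isFibrant_of_fibration (l.π.app (edge 0))
  | succ m ih =>
    obtain ⟨k, hk⟩ := getLimitCone (init m ⋙ F)
    have := ih (fun _ => hF _) (fun b => hs b.castSucc) hk
    have := hs (Fin.last m)
    have := fibration_fst_of_isPullback (isPullback_init hk hl)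
    exact isFibrant_of_fibration (hk.lift (l.whisker (init m)))

lemma weakEquivalence_isLimitMap_of_init {F G : Spine (m + 1) ⥤ C} (hF : ∀ j, IsFibrant (F.obj j))
    (hG : ∀ j, IsFibrant (G.obj j)) (hFs : Fibration (F.map (source (Fin.last m))))
    (hGs : Fibration (G.map (source (Fin.last m)))) (α : F ⟶ G)
    (hα : ∀ j, WeakEquivalence (α.app j)) {k : Cone (init m ⋙ F)} (hk : IsLimit k)
    {k' : Cone (init m ⋙ G)} (hk' : IsLimit k') [IsFibrant k.pt] [IsFibrant k'.pt]
    [WeakEquivalence (hk'.map k (Functor.whiskerLeft (init m) α))] {l : Cone F} (hl : IsLimit l)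
    {l' : Cone G} (hl' : IsLimit l') : WeakEquivalence (hl'.map l α) := by
  have := hα (edge (Fin.last (m + 1)))
  have := hα (vertex (Fin.last m))
  have := hF (vertex (Fin.last m))
  have := hG (vertex (Fin.last m))
  let φ : k.pt ⟶ k'.pt := hk'.map k (Functor.whiskerLeft (init m) α)
  have hφ (j : Spine m) : φ ≫ k'.π.app j = k.π.app j ≫ α.app ((init m).obj j) := hk'.map_π _ _ _
  refine weakEquivalence_of_isPullback_of_isPullback (isPullback_init hk hl)
    (isPullback_init hk' hl') φ (α.app (edge (Fin.last (m + 1))))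
    (α.app (vertex (Fin.last m))) ?_ (α.naturality _).symm _ (hk'.hom_ext fun j => ?_)
    (hl'.map_π _ _ _)
  · refine (Category.assoc _ _ _).symm.trans ((hφ _ =≫ _).trans ((Category.assoc _ _ _).trans
      (Eq.trans ?_ (Category.assoc _ _ _).symm)))
    exact k.π.app _ ≫= (α.naturality _).symm
  · rw [Category.assoc, Category.assoc, hφ, hk'.fac, hk.fac_assoc]
    exact hl'.map_π _ _ _

lemma weakEquivalence_isLimitMap {F G : Spine m ⥤ C} (hF : ∀ j, IsFibrant (F.obj j))
    (hG : ∀ j, IsFibrant (G.obj j)) (hFs : ∀ b, Fibration (F.map (source b)))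
    (hGs : ∀ b, Fibration (G.map (source b))) (α : F ⟶ G) (hα : ∀ j, WeakEquivalence (α.app j))
    {l : Cone F} (hl : IsLimit l) {l' : Cone G} (hl' : IsLimit l') :
    WeakEquivalence (hl'.map l α) := by
  induction m with
  | zero =>
    have := isIso_π_zero hl
    have := isIso_π_zero hl'
    have := hα (edge 0)
    have h : hl'.map l α ≫ l'.π.app (edge 0) = l.π.app (edge 0) ≫ α.app (edge 0) :=
      hl'.map_π _ _ _
    rw [← weakEquivalence_postcomp_iff _ (l'.π.app (edge 0)), h]
    infer_instance
  | succ m ih =>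
    obtain ⟨k, hk⟩ := getLimitCone (init m ⋙ F)
    obtain ⟨k', hk'⟩ := getLimitCone (init m ⋙ G)
    have := isFibrant_pt (F := init m ⋙ F) (fun _ => hF _) (fun b => hFs b.castSucc) hk
    have := isFibrant_pt (F := init m ⋙ G) (fun _ => hG _) (fun b => hGs b.castSucc) hk'
    have := ih (F := init m ⋙ F) (G := init m ⋙ G) (fun _ => hF _) (fun _ => hG _)
      (fun b => hFs b.castSucc) (fun b => hGs b.castSucc)
      (Functor.whiskerLeft (init m) α) (fun _ => hα _) hk hk'
    exact weakEquivalence_isLimitMap_of_init hF hG (hFs _) (hGs _) α hα hk hk' hl hl'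

instance {b : Fin m} {j : Spine m} : Subsingleton (vertex b ⟶ j) where
  allEq := by rintro ⟨⟩ ⟨⟩; rfl

instance (b : Fin m) : Epi (source b) where
  left_cancellation _ _ _ := Subsingleton.elim _ _

lemma exists_extend_of_injective {ι κ : Type*} {β : κ → Type*} {j : ι → κ}
    (hj : Function.Injective j) {P : ∀ k, β k → Prop} (hP : ∀ k, ∃ x, P k x) (y : ∀ i, β (j i))
    (hy : ∀ i, P (j i) (y i)) : ∃ z : ∀ k, β k, (∀ k, P k (z k)) ∧ ∀ i, z (j i) = y i := by
  have h (k : κ) : ∃ x, P k x ∧ ∀ i (hi : j i = k), x = hi ▸ y i := by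
    by_cases hk : ∃ i, j i = k
    · obtain ⟨i, rfl⟩ := hk
      refine ⟨y i, hy i, fun i' hi' => ?_⟩
      obtain rfl := hj hi'
      rfl
    · obtain ⟨x, hx⟩ := hP k
      exact ⟨x, hx, fun i hi => (hk ⟨i, hi⟩).elim⟩
  choose z hz hzy using h
  exact ⟨z, hz, fun i => hzy (j i) i rfl⟩

/-- The diagram `E → V ← E → ⋯ ← E` with `m + 1` copies of `E`. -/
abbrev constSpineIndex {E V : C} (t s : E ⟶ V) (m : ℕ) : MulticospanIndex (spineShape m) C where
  left _ := E
  right _ := V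
  fst _ := t
  snd _ := s

variable {E V : C} [IsFibrant V]

lemma exists_edge_extension {G H : Spine m ⥤ C} {i : G ⟶ H}
    (hi : ∀ j, trivialCofibrations C (i.app j)) {j : Fin m → Fin (m + 1)}
    (hj : Function.Injective j) (φ : ∀ b, edge (j b) ⟶ vertex b)
    (x : ∀ k, G.obj (edge k) ⟶ V) (r : ∀ b, H.obj (vertex b) ⟶ V)
    (hx : ∀ b, G.map (φ b) ≫ i.app (vertex b) ≫ r b = x (j b)) :
    ∃ z : ∀ k, H.obj (edge k) ⟶ V,
      (∀ k, i.app (edge k) ≫ z k = x k) ∧ ∀ b, z (j b) = H.map (φ b) ≫ r b :=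
  exists_extend_of_injective hj (P := fun k z => i.app (edge k) ≫ z = x k)
    (fun _ => exists_extension_of_trivialCofibrations (hi _) _) (fun b => H.map (φ b) ≫ r b)
    (fun b => by rw [← i.naturality_assoc, hx])

lemma isInjectivelyFibrant_constSpine (p : E ⟶ V ⨯ V) [Fibration p] (m : ℕ) :
    IsInjectivelyFibrant (constSpineIndex (p ≫ prod.fst) (p ≫ prod.snd) m).multicospan := by
  rw [isInjectivelyFibrant_iff]
  intro G H i hi a
  let α (k : Fin (m + 1)) : G.obj (edge k) ⟶ E := a.app (edge k)
  let β (b : Fin m) : G.obj (vertex b) ⟶ V := a.app (vertex b)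
  have exists_r (b : Fin m) : ∃ r : H.obj (vertex b) ⟶ V, i.app (vertex b) ≫ r = β b :=
    exists_extension_of_trivialCofibrations (hi _) _
  choose r hr using exists_r
  obtain ⟨t, ht, ht_r⟩ := exists_edge_extension hi (Fin.castSucc_injective m) target
    (fun k => α k ≫ p ≫ prod.fst) r fun b => by rw [hr]; exact a.naturality (target b)
  obtain ⟨s, hs, hs_r⟩ := exists_edge_extension hi (Fin.succ_injective m) source
    (fun k => α k ≫ p ≫ prod.snd) r fun b => by rw [hr]; exact a.naturality (source b)
  have exists_l (k : Fin (m + 1)) :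
      ∃ l : H.obj (edge k) ⟶ E, i.app (edge k) ≫ l = α k ∧ l ≫ p = prod.lift (t k) (s k) :=
    exists_lift_of_trivialCofibrations (hi _) p <| by
      ext
      · simp [ht, prod.lift_fst]
      · simp [hs, prod.lift_snd]
  choose l hl hlp using exists_l
  have hl_fst (k : Fin (m + 1)) : l k ≫ p ≫ prod.fst = t k := by
    rw [reassoc_of% hlp, prod.lift_fst]
  have hl_snd (k : Fin (m + 1)) : l k ≫ p ≫ prod.snd = s k := by
    rw [reassoc_of% hlp, prod.lift_snd]
  refine ⟨multicospanHomMk l r (fun b => ((hl_fst _).trans (ht_r b)).symm)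
    (fun b => ((hl_snd _).trans (hs_r b)).symm), ?_⟩
  ext (k | b)
  exacts [hl k, hr b]

lemma nonempty_fibrantReplacement_constSpine (t s : E ⟶ V) (m : ℕ) :
    Nonempty (FibrantReplacement (constSpineIndex t s m).multicospan) := by
  let F := MorphismProperty.factorizationData (trivialCofibrations C) (fibrations C)
    (prod.lift t s)
  exact ⟨{
    diagram := (constSpineIndex (F.p ≫ prod.fst) (F.p ≫ prod.snd) m).multicospan
    ι := multicospanHomMk (fun _ => F.i) (fun _ => 𝟙 V)
      (fun _ => (by simp [prod.lift_fst] : t ≫ 𝟙 V = F.i ≫ F.p ≫ prod.fst))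
      (fun _ => (by simp [prod.lift_snd] : s ≫ 𝟙 V = F.i ≫ F.p ≫ prod.snd))
    weakEquivalence := by
      rintro (_ | _)
      exacts [(inferInstance : WeakEquivalence F.i), (inferInstance : WeakEquivalence (𝟙 V))]
    fibrant := isInjectivelyFibrant_constSpine F.p m }⟩

lemma isHomotopyLimit_constSpine_iff [IsFibrant E] {t s : E ⟶ V} [Fibration s]
    {l : Cone (constSpineIndex t s m).multicospan} (hl : IsLimit l)
    (c : Multifork (constSpineIndex t s m)) :
    IsHomotopyLimit c ↔ WeakEquivalence (hl.lift c) := by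
  have := nonempty_fibrantReplacement_constSpine t s m
  refine isHomotopyLimit_iff_weakEquivalence_lift hl (fun R l' hl' => ?_) c
  refine weakEquivalence_isLimitMap ?_ R.fibrant.isFibrant (fun _ => ‹Fibration s›)
    (fun b => R.fibrant.fibration_map (source b)) R.ι R.weakEquivalence hl hl'
  rintro (_ | _)
  exacts [‹IsFibrant E›, ‹IsFibrant V›]

end Spine

end Spine

section Monomorphisms

open Simplicial

instance {D D' : Type*} [Category* D] [Category* D'] {x y : D} {x' y' : D'} (f : x ⟶ y)
    (g : x' ⟶ y') [Mono f] [Mono g] : Mono (Prod.mkHom f g) where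
  right_cancellation _ _ h := Prod.ext ((cancel_mono f).1 (congrArg Prod.fst h))
    ((cancel_mono g).1 (congrArg Prod.snd h))

lemma mono_fst {D D' : Type*} [Category* D] [Category* D'] {x y : D × D'} (f : x ⟶ y) [Mono f] :
    Mono f.1 where
  right_cancellation g h w := by
    have : Prod.mkHom g (𝟙 x.2) ≫ f = Prod.mkHom h (𝟙 x.2) ≫ f := Prod.ext w rfl
    exact congrArg Prod.fst ((cancel_mono f).1 this)

lemma mono_snd {D D' : Type*} [Category* D] [Category* D'] {x y : D × D'} (f : x ⟶ y) [Mono f] :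
    Mono f.2 where
  right_cancellation g h w := by
    have : Prod.mkHom (𝟙 x.1) g ≫ f = Prod.mkHom (𝟙 x.1) h ≫ f := Prod.ext rfl w
    exact congrArg Prod.snd ((cancel_mono f).1 this)

instance {D D' : Type*} [Category* D] [Category* D'] (y : D') :
    (Prod.sectL D y).PreservesMonomorphisms where
  preserves f _ := (inferInstance : Mono (Prod.mkHom f (𝟙 y)))

instance {D₁ D₂ D₁' D₂' : Type*} [Category* D₁] [Category* D₂] [Category* D₁'] [Category* D₂']
    (F : D₁ ⥤ D₂) (G : D₁' ⥤ D₂') [F.PreservesMonomorphisms] [G.PreservesMonomorphisms] :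
    (F.prod G).PreservesMonomorphisms where
  preserves f _ :=
    have := mono_fst f
    have := mono_snd f
    (inferInstance : Mono (Prod.mkHom (F.map f.1) (G.map f.2)))

instance {D : Type*} [Category* D] :
    (WithTerminal.incl : D ⥤ WithTerminal D).PreservesMonomorphisms where
  preserves {x _} f _ := by
    refine ⟨fun {z} g h w => ?_⟩
    rcases z with z | _
    · let g' : z ⟶ x := g
      let h' : z ⟶ x := h
      exact (cancel_mono f).1 (w : g' ≫ f = h' ≫ f)
    · exact (WithTerminal.false_of_from_star g).elim

instance : join.PreservesMonomorphisms where
  preserves {x y} f _ := by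
    have hf := SimplexCategory.mono_iff_injective.1 ‹Mono f›
    rw [SimplexCategory.mono_iff_injective]
    change Function.Injective (Fin.cases (0 : Fin (y.len + 2)) fun i => (f.toOrderHom i).succ)
    refine Fin.cons_injective_iff.2 ⟨?_, (Fin.succ_injective _).comp hf⟩
    rintro ⟨i, hi⟩
    exact Fin.succ_ne_zero _ hi

instance {y : SimplexCategory} (f : ⦋0⦌ ⟶ y) : Mono f where
  right_cancellation _ _ _ := Subsingleton.elim _ _

instance (x y : SigmaCatᵒᵖ) : Finite (x ⟶ y) := by
  suffices ∀ a b : SigmaCat, Finite (a ⟶ b) from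
    have := this y.unop x.unop
    .of_injective Quiver.Hom.unop Quiver.Hom.unop_inj
  rintro (a | _) (b | _)
  · exact (inferInstance : Finite ((a.1 ⟶ b.1) × (a.2 ⟶ b.2)))
  · exact (inferInstance : Finite PUnit.{1})
  · exact (inferInstance : Finite PEmpty.{1})
  · exact (inferInstance : Finite PUnit.{1})

end Monomorphisms

section MonoFibrant

variable {C : Type u} [Category.{v} C] [ModelCategory C] {D : Type u₁} [Category.{v₁} D]

/-- A presheaf which is levelwise fibrant and sends monomorphisms to fibrations. This is the part
of injective fibrancy which the homotopy pullbacks below depend on. -/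
class IsMonoFibrant (X : Dᵒᵖ ⥤ C) : Prop where
  isFibrant (X) (x : D) : IsFibrant (X.obj (op x))
  fibration (X) {x y : D} (f : x ⟶ y) [Mono f] : Fibration (X.map f.op)

attribute [instance] IsMonoFibrant.isFibrant IsMonoFibrant.fibration

instance {D' : Type*} [Category* D'] (G : D' ⥤ D) [G.PreservesMonomorphisms] (X : Dᵒᵖ ⥤ C)
    [IsMonoFibrant X] : IsMonoFibrant (G.op ⋙ X) where
  isFibrant x := IsMonoFibrant.isFibrant X (G.obj x)
  fibration f _ := IsMonoFibrant.fibration X (G.map f)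

lemma IsInjectivelyFibrant.isMonoFibrant [∀ x y : Dᵒᵖ, Finite (x ⟶ y)] {X : Dᵒᵖ ⥤ C}
    (hX : IsInjectivelyFibrant X) : IsMonoFibrant X where
  isFibrant x := hX.isFibrant (op x)
  fibration f _ := hX.fibration_map f.op

end MonoFibrant

section Segal

open Simplicial SimplexCategory

lemma commSq_δ_last_mkOfSucc_last (m : ℕ) :
    CommSq (δ (Fin.last (m + 1))).op (mkOfSucc (Fin.last m)).op (const ⦋0⦌ ⦋m⦌ (Fin.last m)).op
      (δ (n := 0) 1).op where
  w := by
    rw [← op_comp, ← op_comp, δ_one_mkOfSucc, const_comp]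
    congr 2
    exact Fin.succAbove_last_apply _

lemma joinMap_δ {n : ℕ} (i : Fin (n + 2)) : joinMap (δ i) = δ i.succ := by
  ext j : 3
  induction j using Fin.cases with
  | zero => rfl
  | succ j => exact (Fin.succ_succAbove_succ i j).symm

variable {C : Type u} [Category.{v} C] (X : SimplicialObject C)

lemma map_δ_last_comp_map_mkOfSucc {m : ℕ} (a : Fin m) :
    X.map (δ (Fin.last (m + 1))).op ≫ X.map (mkOfSucc a).op = X.map (mkOfSucc a.castSucc).op := by
  rw [← X.map_comp, ← op_comp, mkOfSucc_δ_lt (by simp [Fin.lt_def])]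

lemma map_mkOfSucc_last_comp_map_δ_zero (m : ℕ) :
    X.map (mkOfSucc (Fin.last m)).op ≫ X.map (δ (n := 0) 0).op =
      X.map (const ⦋0⦌ ⦋m + 1⦌ (Fin.last (m + 1))).op := by
  rw [← X.map_comp, ← op_comp, δ_zero_mkOfSucc, Fin.succ_last]

/-- The spine diagram of `X` with one edge less, as a restriction of the longer one. -/
def initCompSpineIndexIso (m : ℕ) :
    Spine.init m ⋙ (spineIndex X (m + 1)).multicospan ≅ (spineIndex X m).multicospan :=
  WalkingMulticospan.functorExt (fun _ => Iso.refl _) (fun _ => Iso.refl _)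
    (fun _ => (Category.comp_id _).trans (Category.id_comp _).symm)
    (fun _ => (Category.comp_id _).trans (Category.id_comp _).symm)

variable [ModelCategory C]

/-- The condition that `X_{m+2}` is the homotopy pullback of `X_{m+1}` and `X₁` over `X₀`, along
the last vertex and the source respectively. -/
def SegalSquare (m : ℕ) : Prop :=
  IsHoPullback (X.map (δ (Fin.last (m + 2))).op) (X.map (mkOfSucc (Fin.last (m + 1))).op)
    (X.map (const ⦋0⦌ ⦋m + 1⦌ (Fin.last (m + 1))).op) (X.map (δ (n := 0) 1).op)

variable {X} {m : ℕ}

lemma SegalSquare.of_retract {X' : SimplicialObject C} (ρ : Retract X X') (h : SegalSquare X' m) :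
    SegalSquare X m :=
  IsHoPullback.map_of_retract ρ (commSq_δ_last_mkOfSucc_last _) h

lemma segalSquare_zero_iff : SegalSquare X 0 ↔
    IsHoPullback (X.map (δ (n := 1) 2).op) (X.map (δ (n := 1) 0).op)
      (X.map (const ⦋0⦌ ⦋1⦌ 1).op) (X.map (const ⦋0⦌ ⦋1⦌ 0).op) := by
  rw [← mkOfSucc_one_eq_δ, ← δ_one_eq_const]
  rfl

variable [IsMonoFibrant X]

lemma segalMapIsWeakEquivalence_iff {F : Spine m ⥤ C} (e : F ≅ (spineIndex X m).multicospan)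
    {l : Cone F} (hl : IsLimit l) (ψ : X.obj (op ⦋m + 1⦌) ⟶ l.pt)
    (hψ : ∀ a, ψ ≫ l.π.app (Spine.edge a) ≫ e.hom.app (Spine.edge a) = X.map (mkOfSucc a).op) :
    SegalMapIsWeakEquivalence X m ↔ WeakEquivalence ψ := by
  have hl' := (IsLimit.postcomposeHomEquiv e l).symm hl
  have : ψ = hl'.lift (spineCone X m) :=
    Spine.hom_ext_of_isLimit hl' fun a => (hψ a).trans (hl'.fac (spineCone X m) (Spine.edge a)).symm
  rw [this]
  exact Spine.isHomotopyLimit_constSpine_iff hl' (spineCone X m)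

lemma segalMapIsWeakEquivalence_zero : SegalMapIsWeakEquivalence X 0 := by
  obtain ⟨l, hl⟩ := getLimitCone (spineIndex X 0).multicospan
  have := Spine.isIso_π_zero hl
  have h : hl.lift (spineCone X 0) ≫ l.π.app (Spine.edge 0) = 𝟙 (X.obj (op ⦋1⦌)) :=
    (hl.fac _ _).trans (by rw [← X.map_id, ← op_id, ← mkOfSucc_eq_id]; rfl)
  refine (Spine.isHomotopyLimit_constSpine_iff hl (spineCone X 0)).2 ?_
  rw [← weakEquivalence_postcomp_iff _ (l.π.app (Spine.edge 0)), h]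
  exact (inferInstance : WeakEquivalence (𝟙 (X.obj (op ⦋1⦌))))

lemma segalMapIsWeakEquivalence_succ_iff (h : SegalMapIsWeakEquivalence X m) :
    SegalMapIsWeakEquivalence X (m + 1) ↔ SegalSquare X m := by
  obtain ⟨l, hl⟩ := getLimitCone (spineIndex X (m + 1)).multicospan
  obtain ⟨k, hk⟩ := getLimitCone (Spine.init m ⋙ (spineIndex X (m + 1)).multicospan)
  let φ : X.obj (op ⦋m + 2⦌) ⟶ l.pt := hl.lift (spineCone X (m + 1))
  have hφ (a : Fin (m + 2)) : φ ≫ l.π.app (Spine.edge a) = X.map (mkOfSucc a).op := hl.fac _ _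
  obtain ⟨ψ, hψ⟩ := Spine.exists_lift_of_isLimit hk (T := X.obj (op ⦋m + 1⦌))
    (fun a => X.map (mkOfSucc a).op) (spineCone X m).condition
  have : WeakEquivalence ψ :=
    (segalMapIsWeakEquivalence_iff (initCompSpineIndexIso X m) hk ψ
      fun a => (ψ ≫= Category.comp_id _).trans (hψ a)).1 h
  rw [segalMapIsWeakEquivalence_iff (Iso.refl _) hl φ
    fun a => (φ ≫= Category.comp_id _).trans (hφ a), ← IsHoPullback.iff_of_isPullback
      (Spine.isPullback_init hk hl) φ rfl (hφ _)]
  have hδψ : X.map (δ (Fin.last (m + 2))).op ≫ ψ = φ ≫ hk.lift (l.whisker (Spine.init m)) := by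
    refine Spine.hom_ext_of_isLimit hk fun a => ?_
    rw [Category.assoc, Category.assoc, hψ, hk.fac]
    exact (map_δ_last_comp_map_mkOfSucc X a).trans (hφ a.castSucc).symm
  have hψ_last : ψ ≫ k.π.app (Spine.edge (Fin.last m)) ≫ X.map (δ (n := 0) 0).op =
      X.map (const ⦋0⦌ ⦋m + 1⦌ (Fin.last (m + 1))).op :=
    (Category.assoc _ _ _).symm.trans ((hψ _ =≫ _).trans (map_mkOfSucc_last_comp_map_δ_zero X m))
  have : IsFibrant k.pt := Spine.isFibrant_pt
    (by rintro (_ | _) <;> exact IsMonoFibrant.isFibrant X _)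
    (fun _ => IsMonoFibrant.fibration X (δ (n := 0) 1)) hk
  rw [← hδψ]
  exact (IsHoPullback.iff_of_weakEquivalence ((commSq_δ_last_mkOfSucc_last _).map X).w ψ
    hψ_last).symm

lemma forall_segalMapIsWeakEquivalence_iff :
    (∀ m, SegalMapIsWeakEquivalence X m) ↔ ∀ m, SegalSquare X m := by
  refine ⟨fun h m => (segalMapIsWeakEquivalence_succ_iff (h m)).1 (h (m + 1)), fun h m => ?_⟩
  induction m with
  | zero => exact segalMapIsWeakEquivalence_zero
  | succ m ih => exact (segalMapIsWeakEquivalence_succ_iff ih).2 (h m)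

-- The last edge of `[0] ⋆ [m + 2]` lies in `[m + 2]`, and `[0] ⋆ [1] = [2]`, so the Segal square of
-- the décalage is obtained from that of `X` for `m + 1` by cancelling that for `0`.
lemma SegalSquare.join_op_comp (h : ∀ m, SegalSquare X m) : SegalSquare (join.op ⋙ X) m := by
  have h₀ := segalSquare_zero_iff.1 (h 0)
  have h₁ := h (m + 1)
  have hmk : mkOfSucc (Fin.last (m + 2)) =
      δ (n := 1) 0 ≫ joinMap (mkOfSucc (Fin.last (m + 1))) := by
    ext j : 3
    fin_cases j <;> rfl
  have hconst : const ⦋0⦌ ⦋m + 2⦌ (Fin.last (m + 2)) =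
      const ⦋0⦌ ⦋1⦌ 1 ≫ joinMap (const ⦋0⦌ ⦋m + 1⦌ (Fin.last (m + 1))) := by
    rw [const_comp]
    rfl
  have hδ : δ (Fin.last (m + 3)) = joinMap (δ (Fin.last (m + 2))) := by
    rw [joinMap_δ, Fin.succ_last]
  have hδ_two : δ (n := 1) 2 = joinMap (δ (n := 0) 1) := (joinMap_δ (n := 0) 1).symm
  have : Mono (joinMap (δ (n := 0) 1)) := (inferInstance : Mono (join.map (δ (n := 0) 1)))
  have hw := ((commSq_δ_last_mkOfSucc_last (m + 1)).map (join.op ⋙ X)).w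
  unfold SegalSquare at h₁
  rw [hmk, hconst, hδ, op_comp, op_comp, X.map_comp, X.map_comp, δ_one_eq_const] at h₁
  rw [hδ_two] at h₀
  exact ((IsHoPullback.paste_horiz_iff h₀.flip hw.symm).1 h₁.flip).flip

end Segal

section Bisimplicial

open Simplicial SimplexCategory

/-- The coface `(1, r) ⟶ (2, r)` omitting `i` in the first component. -/
abbrev dv (r : ℕ) (i : Fin 3) : bi 1 r ⟶ bi 2 r :=
  Prod.mkHom (δ i) (𝟙 ⦋r⦌)

lemma tv_comp_dv_zero (r : ℕ) : tv 1 r ≫ dv r 0 = tv 1 r ≫ dv r 1 :=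
  Prod.ext (by ext j : 3; fin_cases j; rfl) rfl

variable {C : Type u} [Category.{v} C] (Z : BisimplicialObject C)

lemma map_mkHom_comm {x y x' y' : SimplexCategory} (f : x ⟶ y) (g : x' ⟶ y') :
    Z.map (Prod.mkHom f (𝟙 y')).op ≫ Z.map (Prod.mkHom (𝟙 x) g).op =
      Z.map (Prod.mkHom (𝟙 y) g).op ≫ Z.map (Prod.mkHom f (𝟙 x')).op := by
  rw [← Z.map_comp, ← Z.map_comp, ← op_comp, ← op_comp]
  congr 2

lemma map_dv_zero_comp_map_tv (r : ℕ) :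
    Z.map (dv r 0).op ≫ Z.map (tv 1 r).op = Z.map (dv r 1).op ≫ Z.map (tv 1 r).op := by
  rw [← Z.map_comp, ← Z.map_comp, ← op_comp, ← op_comp, tv_comp_dv_zero]

/-- The simplicial object `Z_{•,0}` as a retract of `Z_{•,1}`, through the degeneracy and a face in
the second direction. -/
def fixSndRetract : Retract (fixSnd Z 0) (fixSnd Z 1) where
  i :=
    { app n := Z.map (Prod.mkHom (𝟙 n.unop) (σ 0)).op
      naturality _ _ f := map_mkHom_comm Z f.unop (σ (n := 0) 0) }
  r :=
    { app n := Z.map (Prod.mkHom (𝟙 n.unop) (δ (n := 0) 1)).op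
      naturality _ _ f := map_mkHom_comm Z f.unop (δ (n := 0) 1) }
  retract := NatTrans.ext <| funext fun _ =>
    (Z.map_comp _ _).symm.trans ((congrArg (fun f => Z.map (Quiver.Hom.op f))
      (Prod.ext (Category.comp_id _) (Subsingleton.elim (α := ⦋0⦌ ⟶ ⦋0⦌) _ _))).trans (Z.map_id _))

lemma fixFst_pathBisimplicial (q : ℕ) : fixFst (pathBisimplicial Z) q = fixFst Z (q + 1) :=
  CategoryTheory.Functor.ext (fun _ => rfl) fun _ _ f => by
    refine Eq.trans ?_ ((Category.id_comp _).trans (Category.comp_id _)).symm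
    exact congrArg (fun g => Z.map (Quiver.Hom.op (Prod.mkHom g f.unop))) (join.map_id ⦋q⦌)

lemma pathBisimplicial_map_sv (r : ℕ) :
    (pathBisimplicial Z).map (sv 1 r).op = Z.map (dv r 2).op :=
  congrArg (fun f => Z.map (Quiver.Hom.op (Prod.mkHom f (𝟙 ⦋r⦌))))
    ((congrArg joinMap δ_one_eq_const.symm).trans (joinMap_δ (n := 0) 1))

lemma pathBisimplicial_map_tv (r : ℕ) :
    (pathBisimplicial Z).map (tv 1 r).op = Z.map (dv r 1).op :=
  congrArg (fun f => Z.map (Quiver.Hom.op (Prod.mkHom f (𝟙 ⦋r⦌))))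
    ((congrArg joinMap δ_zero_eq_const.symm).trans (joinMap_δ (n := 0) 0))

lemma pathBisimplicial_map_sh (k l : ℕ) :
    (pathBisimplicial Z).map (sh k l).op = Z.map (sh (k + 1) l).op :=
  congrArg (fun f => Z.map (Quiver.Hom.op (Prod.mkHom f (const ⦋0⦌ ⦋l⦌ 0)))) (join.map_id ⦋k⦌)

lemma pathBisimplicial_map_th (k l : ℕ) :
    (pathBisimplicial Z).map (th k l).op = Z.map (th (k + 1) l).op :=
  congrArg (fun f => Z.map (Quiver.Hom.op (Prod.mkHom f (const ⦋0⦌ ⦋l⦌ (Fin.last l)))))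
    (join.map_id ⦋k⦌)

variable [ModelCategory C] {Z} [IsMonoFibrant Z]

lemma IsDoubleSegal.segalSquare_fixSnd (h : IsDoubleSegal Z) (r m : ℕ) :
    SegalSquare (fixSnd Z r) m := by
  have hsucc (r m : ℕ) : SegalSquare (fixSnd Z (r + 1)) m :=
    forall_segalMapIsWeakEquivalence_iff.1 (fun a => (h a r).2) m
  cases r with
  | zero => exact (hsucc 0 m).of_retract (fixSndRetract Z)
  | succ r => exact hsucc r m

lemma IsDoubleSegal.isHoPullback_dv_two_dv_zero (h : IsDoubleSegal Z) (r : ℕ) :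
    IsHoPullback (Z.map (dv r 2).op) (Z.map (dv r 0).op) (Z.map (tv 1 r).op)
      (Z.map (sv 1 r).op) :=
  segalSquare_zero_iff.1 (h.segalSquare_fixSnd r 0)

lemma IsDoubleSegal.pathBisimplicial (h : IsDoubleSegal Z) :
    IsDoubleSegal (pathBisimplicial Z) := by
  refine fun a b => ⟨?_, ?_⟩
  · rw [fixFst_pathBisimplicial]
    exact (h (a + 1) b).1
  · exact forall_segalMapIsWeakEquivalence_iff.2
      (fun _ => SegalSquare.join_op_comp (h.segalSquare_fixSnd (b + 1))) a

lemma isStable_iff : IsStable Z ↔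
    IsHoPullback (Z.map (sv 1 1).op) (Z.map (sh 1 1).op) (Z.map (sh 0 1).op) (Z.map (sv 1 0).op) ∧
    IsHoPullback (Z.map (th 1 1).op) (Z.map (tv 1 1).op) (Z.map (tv 1 0).op) (Z.map (th 0 1).op) :=
  and_congr (isHomotopyLimit_iff_isHoPullback _) (isHomotopyLimit_iff_isHoPullback _)

lemma IsDoubleSegal.isHoPullback_dv_two_sh (hd : IsDoubleSegal Z)
    (h : IsHoPullback (Z.map (sv 1 1).op) (Z.map (sh 1 1).op) (Z.map (sh 0 1).op)
      (Z.map (sv 1 0).op)) :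
    IsHoPullback (Z.map (dv 1 2).op) (Z.map (sh 2 1).op) (Z.map (sh 1 1).op)
      (Z.map (dv 0 2).op) := by
  have segal₁ := (hd.isHoPullback_dv_two_dv_zero 1).flip
  have segal₀ := (hd.isHoPullback_dv_two_dv_zero 0).flip
  have outer := (IsHoPullback.paste_horiz_iff h.flip segal₁.w).2 segal₁
  rw [map_mkHom_comm, map_mkHom_comm] at outer
  exact ((IsHoPullback.paste_horiz_iff segal₀ (map_mkHom_comm Z _ _).symm).1 outer).flip

lemma IsDoubleSegal.isHoPullback_th_dv_one (hd : IsDoubleSegal Z)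
    (h : IsHoPullback (Z.map (th 1 1).op) (Z.map (tv 1 1).op) (Z.map (tv 1 0).op)
      (Z.map (th 0 1).op)) :
    IsHoPullback (Z.map (th 2 1).op) (Z.map (dv 1 1).op) (Z.map (dv 0 1).op)
      (Z.map (th 1 1).op) := by
  have segal₁ := hd.isHoPullback_dv_two_dv_zero 1
  have segal₀ := hd.isHoPullback_dv_two_dv_zero 0
  have outer := (IsHoPullback.paste_horiz_iff h segal₁.w).2 segal₁
  rw [map_mkHom_comm, map_mkHom_comm] at outer
  have last_edge := (IsHoPullback.paste_horiz_iff segal₀ (map_mkHom_comm Z _ _).symm).1 outer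
  have last_vertex := (IsHoPullback.paste_vert_iff h (map_mkHom_comm Z _ _).symm).2 last_edge
  rw [map_dv_zero_comp_map_tv, map_dv_zero_comp_map_tv] at last_vertex
  exact (IsHoPullback.paste_vert_iff h (map_mkHom_comm Z _ _).symm).1 last_vertex

lemma IsStable.pathBisimplicial (h : IsStable Z) (hd : IsDoubleSegal Z) :
    IsStable (pathBisimplicial Z) := by
  obtain ⟨hs, ht⟩ := isStable_iff.1 h
  rw [isStable_iff, pathBisimplicial_map_sv, pathBisimplicial_map_sv, pathBisimplicial_map_sh,
    pathBisimplicial_map_sh, pathBisimplicial_map_tv, pathBisimplicial_map_tv,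
    pathBisimplicial_map_th, pathBisimplicial_map_th]
  exact ⟨hd.isHoPullback_dv_two_sh hs, hd.isHoPullback_th_dv_one ht⟩

end Bisimplicial

section Augmentation

variable {C : Type u} [Category.{v} C] [ModelCategory C] {Y : PreaugmentedBisimplicialObject C}

variable (Y) in
lemma augmentation_initialPath : augmentation (initialPath Y) = pathAugmentation Y := by
  have : toZero (bi 0 0) = 𝟙 _ := Prod.ext (Subsingleton.elim _ _) (Subsingleton.elim _ _)
  change pathAugmentation Y ≫ (pathBisimplicial (underlying Y)).map (toZero (bi 0 0)).op = _
  rw [this, op_id, CategoryTheory.Functor.map_id, Category.comp_id]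

variable [IsMonoFibrant (underlying Y)] [IsFibrant (minusOne Y)]

instance : IsMonoFibrant (underlying (initialPath Y)) :=
  (inferInstance : IsMonoFibrant (pathBisimplicial (underlying Y)))

instance : IsFibrant (pathMinusOne Y) :=
  isFibrant_of_fibration (pullback.snd ((underlying Y).map (tv 1 0).op) (augmentation Y))

instance : IsFibrant (minusOne (initialPath Y)) :=
  (inferInstance : IsFibrant (pathMinusOne Y))

lemma isAugmented_iff {E E' : C} {p : E ⟶ (underlying Y).obj (op (bi 1 0))} {q : E ⟶ minusOne Y}
    {p' : E' ⟶ (underlying Y).obj (op (bi 0 1))} {q' : E' ⟶ minusOne Y}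
    (hE : IsPullback p q ((underlying Y).map (tv 1 0).op) (augmentation Y))
    (hE' : IsPullback p' q' ((underlying Y).map (sh 0 1).op) (augmentation Y)) :
    IsAugmented Y ↔ WeakEquivalence (p ≫ (underlying Y).map (sv 1 0).op) ∧
      WeakEquivalence (p' ≫ (underlying Y).map (th 0 1).op) :=
  and_congr (projectionThenIsWeakEquivalence_iff hE) (projectionThenIsWeakEquivalence_iff hE')

lemma isAugmented_initialPath_iff {K K' : C}
    {k : K ⟶ (underlying Y).obj (op (bi 2 0))} {l : K ⟶ pathMinusOne Y}
    {k' : K' ⟶ (underlying Y).obj (op (bi 1 1))} {l' : K' ⟶ pathMinusOne Y}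
    (hK : IsPullback k l ((underlying Y).map (dv 0 1).op) (pathAugmentation Y))
    (hK' : IsPullback k' l' ((underlying Y).map (sh 1 1).op) (pathAugmentation Y)) :
    IsAugmented (initialPath Y) ↔ WeakEquivalence (k ≫ (underlying Y).map (dv 0 2).op) ∧
      WeakEquivalence (k' ≫ (underlying Y).map (th 1 1).op) := by
  rw [← pathBisimplicial_map_tv, ← augmentation_initialPath] at hK
  rw [← pathBisimplicial_map_sh, ← augmentation_initialPath] at hK'
  rw [← pathBisimplicial_map_sv, ← pathBisimplicial_map_th]
  exact isAugmented_iff hK hK'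

lemma IsAugmented.initialPath (ha : IsAugmented Y) (hd : IsDoubleSegal (underlying Y))
    (hs : IsStable (underlying Y)) : IsAugmented (initialPath Y) := by
  have hE := IsPullback.of_hasPullback ((underlying Y).map (tv 1 0).op) (augmentation Y)
  obtain ⟨E', p', q', hE'⟩ := exists_isPullback ((underlying Y).map (sh 0 1).op) (augmentation Y)
  obtain ⟨K, k, l, hK⟩ := exists_isPullback ((underlying Y).map (dv 0 1).op) (pathAugmentation Y)
  obtain ⟨K', k', l', hK'⟩ := exists_isPullback ((underlying Y).map (sh 1 1).op)
    (pathAugmentation Y)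
  obtain ⟨_, _⟩ := (isAugmented_iff hE hE').1 ha
  have := fibration_fst_of_isPullback hE'.flip
  have : IsFibrant E' := isFibrant_of_fibration q'
  exact (isAugmented_initialPath_iff hK hK').2
    ⟨weakEquivalence_fst_comp_of_isHoPullback (hd.isHoPullback_dv_two_dv_zero 0)
      (map_dv_zero_comp_map_tv _ 0).symm hE hE hK,
    weakEquivalence_fst_comp_of_isHoPullback (isStable_iff.1 hs).2 (map_mkHom_comm _ _ _).symm
      hE hE' hK'⟩

end Augmentation

end DoubleSegal

theorem mainTheorem10_general {C : Type u} [Category.{v} C] [ModelCategory C]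
    (Y : DoubleSegal.PreaugmentedBisimplicialObject C)
    [DoubleSegal.IsMonoFibrant (DoubleSegal.underlying Y)] [IsFibrant (DoubleSegal.minusOne Y)]
    (hY : DoubleSegal.IsAugmentedStableDoubleSegal Y) :
    DoubleSegal.IsAugmentedStableDoubleSegal (DoubleSegal.initialPath Y) where
  doubleSegal := hY.doubleSegal.pathBisimplicial
  stable := hY.stable.pathBisimplicial hY.doubleSegal
  augmented := hY.augmented.initialPath hY.doubleSegal hY.stable

theorem mainTheorem10 {C : Type u} [Category.{v} C] [ModelCategory C]
    [DoubleSegal.IsCombinatorial.{w} C]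
    (Y : DoubleSegal.PreaugmentedBisimplicialObject C)
    (hfib : DoubleSegal.IsInjectivelyFibrant Y)
    (hY : DoubleSegal.IsAugmentedStableDoubleSegal Y) :
    DoubleSegal.IsAugmentedStableDoubleSegal (DoubleSegal.initialPath Y) :=
  have := hfib.isMonoFibrant
  mainTheorem10_general Y hY
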